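/- For $r\in\mathbb N$ and parameters $\Theta_j=(w_{x,j},w_{y,j},b_{x,j},b_{y,j},a_j)\in\mathbb R^5$, $j=1,\dots,r$, let $$\Upsilon(x,y)=\sum_{j=1}^r a_j\tanh(w_{x,j}x+b_{x,j})\tanh(w_{y,j}y+b_{y,j}).$$ Let $\mathcal F[g](k)=\frac1{2\pi}\int_{\mathbb R^2}g(x,y)e^{-i(k_xx+k_yy)}\,dx\,dy$ be the unitary Fourier transform, understood in the sense of tempered distributions. It is evaluated at frequencies near which it is a continuous function. Let $k^1=(k^1_x,k^1_y)$ and $k^2=(k^2_x,k^2_y)$ be frequencies with $k_x^2>k_x^1>0$ and $k_y^2>k_y^1>0$, and let the target $f$ be a tempered distribution on $\mathbb R^2$ such that $\mathcal F[f]$ is a continuous function near $k^1$ and near $k^2$. For $k\in\{k^1,k^2\}$ define the spectral error $D(k)=\mathcal F[\Upsilon](k)-\mathcal F[f](k)$ and the spectral loss $L(k)=|D(k)|^2$, both as functions of the parameters. Whenever all weights $w_{x,j},w_{y,j}$ are nonzero, $\mathcal F[\Upsilon]$ is a continuous function near $k^1$ and near $k^2$, so that $D$ and $L$ are well defined there.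 Let $J\subseteq\{1,\dots,r\}$ be a set of neurons (for instance a single neuron, $J=\{j\}$, or all neurons). Fix real numbers $a_j$, $b_{x,j}\neq0$, $b_{y,j}\neq0$ for all $j$, the nonzero weights of the neurons outside $J$, and the signs of the (nonzero) weights of the neurons in $J$. The magnitudes $(|w_{x,j}|,|w_{y,j}|)_{j\in J}$ are variable. Suppose that there are $c_1,c_2,\delta_0>0$ with $|D(k^1)|>c_1$ and $|D(k^2)|<c_2$ for all magnitudes in $((0,\delta_0]^2)^J$. Then $$\lim_{\delta\to0^+}\frac{\mu\left(\left\{(|w_{x,j}|,|w_{y,j}|)_{j\in J}:\ \left|\frac{\partial L(k^1)}{\partial\Theta_{jl}}\right|\ge\left|\frac{\partial L(k^2)}{\partial\Theta_{jl}}\right|\ \text{for all } j\in J \text{ and all } l\right\}\cap\left((0,\delta]^2\right)^J\right)}{\delta^{2|J|}}=1,$$ where $\Theta_{jl}$ runs over the five parameters $w_{x,j},w_{y,j},b_{x,j},b_{y,j},a_j$ of the neuron $j$ (the set requires that these partial derivatives of $L(k^1)$ and $L(k^2)$ exist) and $\mu$ is Lebesgue measure on $(\mathbb R^2)^J$. For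 $J=\{j\}$ the measure is two-dimensional and the denominator is $\delta^2$. -/

import Mathlib

open MeasureTheory Filter Topology Set
open scoped ENNReal FourierTransform SchwartzMap

/-- The plane `ℝ²`; the coordinates `0` and `1` are the `x`- and the `y`-direction. -/
abbrev Plane := EuclideanSpace ℝ (Fin 2)

/-- The five trainable parameters of a neuron: the output coefficient `a`, the weights `w_x`, `w_y`
and the biases `b_x`, `b_y`. -/
inductive ParamKind
  | coeff | weightX | weightY | biasX | biasY
  deriving DecidableEq

/-- The parameters `Θ` of a network with `r` neurons; `Θ j l` is the parameter of kind `l` of the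
neuron `j`. -/
abbrev Params (r : ℕ) := Fin r → ParamKind → ℝ

/-- The network `Υ(x, y) = ∑ j, a_j tanh (w_{x,j} x + b_{x,j}) tanh (w_{y,j} y + b_{y,j})`. -/
noncomputable def tnn {r : ℕ} (Θ : Params r) (p : Plane) : ℝ :=
  ∑ j, Θ j .coeff * Real.tanh (Θ j .weightX * p 0 + Θ j .biasX)
    * Real.tanh (Θ j .weightY * p 1 + Θ j .biasY)

theorem continuous_tanh_real : Continuous Real.tanh := by
  have h : Real.tanh = fun x => Real.sinh x / Real.cosh x := by
    funext x
    exact Real.tanh_eq_sinh_div_cosh x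
  rw [h]
  exact Real.continuous_sinh.div Real.continuous_cosh fun x => (Real.cosh_pos x).ne'

theorem abs_tanh_real_le_one (x : ℝ) : |Real.tanh x| ≤ 1 := by
  rw [Real.tanh_eq_sinh_div_cosh, abs_div, abs_of_pos (Real.cosh_pos x),
    div_le_one (Real.cosh_pos x)]
  refine abs_le_of_sq_le_sq ?_ (Real.cosh_pos x).le
  nlinarith [Real.cosh_sq x]

/-- The network is a bounded measurable function of `(x, y)`. -/
theorem memLp_tnn {r : ℕ} (Θ : Params r) :
    MemLp (fun p : Plane => (tnn Θ p : ℂ)) ∞ (volume : Measure Plane) := by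
  refine memLp_top_of_bound (C := ∑ j, |Θ j .coeff|) ?_ ?_
  · refine Continuous.aestronglyMeasurable ?_
    have h := continuous_tanh_real
    unfold tnn
    fun_prop
  · refine Eventually.of_forall fun p => ?_
    rw [Complex.norm_real, Real.norm_eq_abs]
    refine (Finset.abs_sum_le_sum_abs _ _).trans (Finset.sum_le_sum fun j _ => ?_)
    rw [abs_mul, abs_mul]
    have h1 := abs_tanh_real_le_one (Θ j .weightX * p 0 + Θ j .biasX)
    have h2 := abs_tanh_real_le_one (Θ j .weightY * p 1 + Θ j .biasY)
    exact mul_le_of_le_one_right (by positivity) h2 |>.trans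
      (mul_le_of_le_one_right (abs_nonneg _) h1)

/-- The network as a tempered distribution on the plane. -/
noncomputable def tnnDist {r : ℕ} (Θ : Params r) : 𝓢'(Plane, ℂ) :=
  ((memLp_tnn Θ).toLp (fun p : Plane => (tnn Θ p : ℂ)) : Lp ℂ ∞ (volume : Measure Plane))

/-- In a neighbourhood of the point `k` the distribution `T` is a continuous function, and the
value of that function at `k` is `z`. -/
def HasValueAt (T : 𝓢'(Plane, ℂ)) (k : Plane) (z : ℂ) : Prop :=
  ∃ (U : Set Plane) (g : Plane → ℂ), IsOpen U ∧ k ∈ U ∧ ContinuousOn g U ∧ g k = z ∧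
    ∀ φ : 𝓢(Plane, ℂ), HasCompactSupport φ → tsupport φ ⊆ U → T φ = ∫ ξ, φ ξ * g ξ

open Classical in
/-- The value at `k` of a distribution that is a continuous function near `k`. -/
noncomputable def valueAt (T : 𝓢'(Plane, ℂ)) (k : Plane) : ℂ :=
  if h : ∃ z, HasValueAt T k z then h.choose else 0

theorem HasValueAt.unique {T : 𝓢'(Plane, ℂ)} {k : Plane} {z z' : ℂ}
    (h : HasValueAt T k z) (h' : HasValueAt T k z') : z = z' := by
  obtain ⟨U, g, hU, hkU, hg, rfl, hT⟩ := h
  obtain ⟨V, g', hV, hkV, hg', rfl, hT'⟩ := h'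
  have hUV : IsOpen (U ∩ V) := hU.inter hV
  have hc : ContinuousOn (fun ξ => g ξ - g' ξ) (U ∩ V) :=
    (hg.mono inter_subset_left).sub (hg'.mono inter_subset_right)
  have hint : ∀ (G : Plane → ℂ) (φ : 𝓢(Plane, ℂ)) (W : Set Plane), ContinuousOn G W →
      HasCompactSupport φ → tsupport φ ⊆ W → Integrable fun ξ => φ ξ * G ξ := by
    intro G φ W hG hφ hφW
    have h0 : IntegrableOn (fun ξ => φ ξ * G ξ) (tsupport φ) :=
      (φ.continuous.continuousOn.mul (hG.mono hφW)).integrableOn_compact hφ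
    refine (integrableOn_iff_integrable_of_support_subset ?_).1 h0
    intro ξ hξ
    refine subset_tsupport _ ?_
    intro h1
    exact hξ (by simp [h1])
  have hae : ∀ᵐ ξ ∂(volume : Measure Plane), ξ ∈ U ∩ V → g ξ - g' ξ = 0 := by
    refine hUV.ae_eq_zero_of_integral_contDiff_smul_eq_zero
      (hc.locallyIntegrableOn hUV.measurableSet) ?_
    intro ψ hψ hψc hψs
    have h1 : HasCompactSupport (Complex.ofRealCLM ∘ ψ) := hψc.comp_left rfl
    have h2 : ContDiff ℝ (⊤ : ℕ∞) (Complex.ofRealCLM ∘ ψ) := Complex.ofRealCLM.contDiff.comp hψ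
    let φ : 𝓢(Plane, ℂ) := h1.toSchwartzMap h2
    have hφ : ∀ ξ, φ ξ = (ψ ξ : ℂ) := fun ξ => rfl
    have hφc : HasCompactSupport φ := h1
    have hsupp : Function.support φ ⊆ Function.support ψ := by
      intro ξ hξ h
      exact hξ (by simp [hφ, h])
    have hφs : tsupport φ ⊆ U ∩ V := (closure_mono hsupp).trans hψs
    have e1 := hT φ hφc (hφs.trans inter_subset_left)
    have e2 := hT' φ hφc (hφs.trans inter_subset_right)
    have i1 := hint g φ U hg hφc (hφs.trans inter_subset_left)
    have i2 := hint g' φ V hg' hφc (hφs.trans inter_subset_right)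
    calc ∫ ξ, ψ ξ • (g ξ - g' ξ) = ∫ ξ, (φ ξ * g ξ - φ ξ * g' ξ) := by
          refine integral_congr_ae (Eventually.of_forall fun ξ => ?_)
          simp [hφ, mul_sub]
      _ = 0 := by rw [integral_sub i1 i2, ← e1, ← e2, sub_self]
  have hae' : (fun ξ => g ξ - g' ξ) =ᵐ[volume.restrict (U ∩ V)] fun _ => 0 :=
    (ae_restrict_iff' hUV.measurableSet).2 hae
  have := Measure.eqOn_open_of_ae_eq hae' hUV hc continuousOn_const ⟨hkU, hkV⟩
  exact sub_eq_zero.1 this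

theorem HasValueAt.valueAt_eq {T : 𝓢'(Plane, ℂ)} {k : Plane} {z : ℂ} (h : HasValueAt T k z) :
    valueAt T k = z := by
  have hex : ∃ z, HasValueAt T k z := ⟨z, h⟩
  unfold valueAt
  rw [dif_pos hex]
  exact hex.choose_spec.unique h

/-- The unitary Fourier transform of `T`, in angular frequency, is a continuous function near the
frequency `k`. (Mathlib's `𝓕` has the kernel `exp (-2πi⟨x, ξ⟩)`, so that `ξ = k / 2π`.) -/
def HasSpectrumAt (T : 𝓢'(Plane, ℂ)) (k : Plane) : Prop :=
  ∃ z, HasValueAt (𝓕 T) ((2 * Real.pi)⁻¹ • k) z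

/-- The unitary Fourier transform `F[T](k) = (2π)⁻¹ ∫ T(x) exp (-i⟨k, x⟩) dx` in the sense of
tempered distributions, evaluated at a frequency `k` near which it is a continuous function. -/
noncomputable def spectrumAt (T : 𝓢'(Plane, ℂ)) (k : Plane) : ℂ :=
  ((2 * Real.pi)⁻¹ : ℝ) * valueAt (𝓕 T) ((2 * Real.pi)⁻¹ • k)

/-- The spectral error `D(k) = F[Υ](k) - F[f](k)` for the target `f`. -/
noncomputable def spectralError {r : ℕ} (f : 𝓢'(Plane, ℂ)) (Θ : Params r) (k : Plane) : ℂ :=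
  spectrumAt (tnnDist Θ) k - spectrumAt f k

/-- The spectral loss `L(k) = |D(k)|²`. -/
noncomputable def spectralLoss {r : ℕ} (f : 𝓢'(Plane, ℂ)) (Θ : Params r) (k : Plane) : ℝ :=
  ‖spectralError f Θ k‖ ^ 2

/-- The spectral loss as a function of the single parameter `Θ j l`. -/
noncomputable def lossAlong {r : ℕ} (f : 𝓢'(Plane, ℂ)) (Θ : Params r) (k : Plane)
    (j : Fin r) (l : ParamKind) (t : ℝ) : ℝ :=
  spectralLoss f (Function.update Θ j (Function.update (Θ j) l t)) k

/-- The partial derivatives of `L(k¹)` and `L(k²)` with respect to `Θ j l` exist, and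
`|∂L(k¹)/∂Θ_{jl}| ≥ |∂L(k²)/∂Θ_{jl}|`. -/
def Dominates {r : ℕ} (f : 𝓢'(Plane, ℂ)) (k₁ k₂ : Plane) (Θ : Params r)
    (j : Fin r) (l : ParamKind) : Prop :=
  DifferentiableAt ℝ (lossAlong f Θ k₁ j l) (Θ j l) ∧
  DifferentiableAt ℝ (lossAlong f Θ k₂ j l) (Θ j l) ∧
  |deriv (lossAlong f Θ k₁ j l) (Θ j l)| ≥ |deriv (lossAlong f Θ k₂ j l) (Θ j l)|

/-- The parameters `Θ` after the weights of the neurons `j ∈ J` have been given the absolute values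
`(|w_{x,j}|, |w_{y,j}|) = m j`. The signs of these weights and all other parameters are kept. -/
noncomputable def withMagnitudes {r : ℕ} (Θ : Params r) (J : Finset (Fin r)) (m : J → ℝ × ℝ) :
    Params r := fun j l =>
  if h : j ∈ J then
    match l with
    | .weightX => SignType.sign (Θ j .weightX) * (m ⟨j, h⟩).1
    | .weightY => SignType.sign (Θ j .weightY) * (m ⟨j, h⟩).2
    | l => Θ j l
  else Θ j l

/-- The box of all magnitudes with `(|w_{x,j}|, |w_{y,j}|) ∈ (0, δ]²` for every `j ∈ J`. -/
def magnitudeBox {r : ℕ} (J : Finset (Fin r)) (δ : ℝ) : Set (J → ℝ × ℝ) :=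
  {m | ∀ j, m j ∈ Ioc 0 δ ×ˢ Ioc 0 δ}

/-! Off the coordinate axes the spectrum of a neuron has a closed form: `a` times a real amplitude
times a wave of modulus one. The amplitude is, up to a constant, the product over both axes of `π /
(|w| sinh (π k / (2 w)))`; the wave is `exp (i (k_x b_x / w_x + k_y b_y / w_y))`. Hence
(`hasDerivAt_lossAlong`) each partial derivative of the loss is `2 · amplitude · scale · ⟨D, wave ·
phase⟩`, where `scale` is real and `phase` is 1, `i` or a weight-dependent complex number.

As the magnitudes shrink, the amplitude at the higher frequency is negligible against the one at the
lower frequency (`isLittleO_neuronAmp`). The quotient of the scales does not depend on the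
parameters of the neuron, the phases converge to nonzero limits, and `D` converges at both
frequencies. The limit `C` of `D(k¹)` is nonzero because of the lower bound `c₁`. So the lower
frequency can lose only where `⟨C, wave · phase limit⟩` is nearly zero (`eventually_dominates`).

With magnitudes `x`, `y` this inner product is a nonzero constant times `cos (α / x + β / y + γ)`,
and `α ≠ 0` because `b_x ≠ 0`. The cosine oscillates so fast near `x = 0` that it lies below a
threshold `η` only on a proportion `ε` of every small interval, where `η` depends on `ε` but not on
the shift (`exists_volume_cos_div_le`). Slicing, the product structure of the box and a union bound
over the finitely many pairs of neuron and parameter finish the proof. -/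

/-! ### The Fourier integral of the derivative of tanh, by a Beta integral. -/

theorem hasDerivAt_tanh_real (x : ℝ) : HasDerivAt Real.tanh ((Real.cosh x ^ 2)⁻¹) x := by
  have h : Real.tanh = fun x => Real.sinh x / Real.cosh x := by
    funext x
    exact Real.tanh_eq_sinh_div_cosh x
  rw [h]
  have hc := (Real.cosh_pos x).ne'
  refine ((Real.hasDerivAt_sinh x).div (Real.hasDerivAt_cosh x) hc).congr_deriv ?_
  rw [inv_eq_one_div]
  congr 1
  linear_combination Real.cosh_sq x

theorem sigmoid_eq_exp_mul (u : ℝ) :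
    Real.sigmoid u = Real.exp u * (1 - Real.sigmoid u) := by
  rw [Real.sigmoid_def, Real.exp_neg]
  have := Real.exp_pos u
  field_simp
  ring

theorem inv_cosh_sq_eq_sigmoid (x : ℝ) :
    (Real.cosh x ^ 2)⁻¹ = 4 * (Real.sigmoid (2 * x) * (1 - Real.sigmoid (2 * x))) := by
  rw [Real.sigmoid_def, Real.cosh_eq, Real.exp_neg, Real.exp_neg]
  have h : Real.exp (2 * x) = Real.exp x ^ 2 := by rw [← Real.exp_nat_mul]; norm_num
  rw [h]
  have := Real.exp_pos x
  field_simp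
  ring

/-- The integrand is the derivative of the sigmoid, so the change of variables `t = σ(u)` turns the
claim into integrability of the constant 1 on `(0, 1)`. -/
theorem integrable_sigmoid_mul :
    Integrable fun u : ℝ => Real.sigmoid u * (1 - Real.sigmoid u) := by
  have h := (integrableOn_image_iff_integrableOn_abs_deriv_smul (s := univ)
    (f := Real.sigmoid) MeasurableSet.univ
    (fun x _ => (Real.hasDerivAt_sigmoid x).hasDerivWithinAt)
    Real.sigmoid_injective.injOn (fun _ => (1 : ℝ))).1 (by
      rw [image_univ, Real.range_sigmoid]
      exact integrableOn_const (by simp))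
  rw [integrableOn_univ] at h
  refine h.congr (Eventually.of_forall fun x => ?_)
  have h1 := Real.sigmoid_pos x
  have h2 := Real.sigmoid_lt_one x
  simp only [smul_eq_mul, mul_one]
  exact abs_of_pos (mul_pos h1 (by linarith))

theorem integrable_inv_cosh_sq : Integrable fun x : ℝ => (Real.cosh x ^ 2)⁻¹ := by
  simp_rw [inv_cosh_sq_eq_sigmoid]
  exact (integrable_sigmoid_mul.comp_mul_left' two_ne_zero).const_mul 4

/-- Substitute `t = σ(u)`: then `dt = σ (1 - σ) du` and `e^u = t / (1 - t)`, so the exponential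
becomes `t^(-is) (1 - t)^(is)`. -/
theorem integral_exp_mul_sigmoid (s : ℝ) :
    ∫ u : ℝ, Complex.exp (-(s * u) * Complex.I) *
      ((Real.sigmoid u * (1 - Real.sigmoid u) : ℝ) : ℂ) =
      Complex.betaIntegral (1 - s * Complex.I) (1 + s * Complex.I) := by
  have h := integral_image_eq_integral_abs_deriv_smul (s := univ)
    (f := Real.sigmoid) MeasurableSet.univ
    (fun x _ => (Real.hasDerivAt_sigmoid x).hasDerivWithinAt)
    Real.sigmoid_injective.injOn
    (fun x : ℝ => (x : ℂ) ^ ((1 - s * Complex.I : ℂ) - 1) *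
      (1 - (x : ℂ)) ^ ((1 + s * Complex.I : ℂ) - 1))
  rw [image_univ, Real.range_sigmoid, Measure.restrict_univ] at h
  rw [Complex.betaIntegral, intervalIntegral.integral_of_le zero_le_one,
    integral_Ioc_eq_integral_Ioo, h]
  refine integral_congr_ae (Eventually.of_forall fun u => ?_)
  have h1 := Real.sigmoid_pos u
  have h2 : 0 < 1 - Real.sigmoid u := sub_pos.2 (Real.sigmoid_lt_one u)
  have hl : Real.log (Real.sigmoid u) = u + Real.log (1 - Real.sigmoid u) := by
    conv_lhs => rw [sigmoid_eq_exp_mul u]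
    rw [Real.log_mul (Real.exp_pos u).ne' h2.ne', Real.log_exp]
  have e1 : (1 - (Real.sigmoid u : ℂ)) = ((1 - Real.sigmoid u : ℝ) : ℂ) := by push_cast; rfl
  simp only []
  rw [abs_of_pos (mul_pos h1 h2), e1, Complex.cpow_def_of_ne_zero (by exact_mod_cast h1.ne'),
    Complex.cpow_def_of_ne_zero (by exact_mod_cast h2.ne'), ← Complex.ofReal_log h1.le,
    ← Complex.ofReal_log h2.le, ← Complex.exp_add, hl, Complex.real_smul, mul_comm]
  congr 2
  push_cast
  ring

/-- Since `Γ(2) = 1`, the Beta integral is `Γ(1 - is) Γ(1 + is)`. Pulling the factor `is` out of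
`Γ(1 + is)` leaves Euler's reflection formula at `is`, with `sin (iπs) = i sinh (πs)`. -/
theorem betaIntegral_one_sub_one_add {s : ℝ} (hs : s ≠ 0) :
    Complex.betaIntegral (1 - s * Complex.I) (1 + s * Complex.I) =
      ((Real.pi * s / Real.sinh (Real.pi * s) : ℝ) : ℂ) := by
  have h := Complex.Gamma_mul_Gamma_eq_betaIntegral (s := 1 - s * Complex.I)
    (t := 1 + s * Complex.I) (by simp) (by simp)
  have h2 : (1 - s * Complex.I : ℂ) + (1 + s * Complex.I) = ((1 : ℕ) : ℂ) + 1 := by push_cast; ring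
  rw [h2, Complex.Gamma_nat_eq_factorial] at h
  have hsI : (s * Complex.I : ℂ) ≠ 0 := by simp [hs]
  have h3 := Complex.Gamma_mul_Gamma_one_sub (s * Complex.I)
  rw [add_comm (1 : ℂ)] at h ⊢
  rw [Complex.Gamma_add_one _ hsI] at h
  have h4 : Complex.sin (Real.pi * (s * Complex.I)) = Complex.sinh (Real.pi * s) * Complex.I := by
    rw [← mul_assoc, Complex.sin_mul_I]
  have h5 : Complex.sinh (Real.pi * s) ≠ 0 := by
    rw [← Complex.ofReal_mul, ← Complex.ofReal_sinh, Complex.ofReal_ne_zero, Ne, Real.sinh_eq_zero]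
    positivity
  rw [h4] at h3
  simp only [Nat.factorial_one, Nat.cast_one, one_mul] at h
  rw [← h]
  push_cast
  calc _ = s * Complex.I * (Complex.Gamma (s * Complex.I) * Complex.Gamma (1 - s * Complex.I)) := by
        ring
    _ = _ := by
      rw [h3]
      field_simp [Complex.I_ne_zero]

/-- The Fourier integral of `1 / cosh ^ 2`. -/
theorem integral_exp_mul_inv_cosh_sq {k : ℝ} (hk : k ≠ 0) :
    ∫ x : ℝ, Complex.exp (-(k * x) * Complex.I) * (((Real.cosh x ^ 2)⁻¹ : ℝ) : ℂ) =
      ((Real.pi * k / Real.sinh (Real.pi * k / 2) : ℝ) : ℂ) := by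
  -- The substitution `u = 2x` halves the frequency, because `1 / cosh² x` is `4 σ (1 - σ)` at `2x`.
  have h := Measure.integral_comp_mul_left (fun u : ℝ => 4 *
    (Complex.exp (-(((k / 2 : ℝ) : ℂ) * u) * Complex.I) *
      ((Real.sigmoid u * (1 - Real.sigmoid u) : ℝ) : ℂ))) 2
  rw [integral_const_mul 4 fun u : ℝ => Complex.exp (-(((k / 2 : ℝ) : ℂ) * u) * Complex.I) *
      ((Real.sigmoid u * (1 - Real.sigmoid u) : ℝ) : ℂ), integral_exp_mul_sigmoid,
    betaIntegral_one_sub_one_add (div_ne_zero hk two_ne_zero)] at h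
  calc _ = _ := ?_
    _ = _ := h
    _ = _ := ?_
  · refine integral_congr_ae (Eventually.of_forall fun x => ?_)
    simp only []
    rw [inv_cosh_sq_eq_sigmoid]
    push_cast
    rw [show ((k : ℂ) / 2 * (2 * x)) = k * x by ring]
    ring
  · rw [abs_of_pos (by norm_num : (0 : ℝ) < 2⁻¹), Complex.real_smul,
      show Real.pi * (k / 2) = Real.pi * k / 2 by ring]
    push_cast
    ring

/-! ### The transform of one tanh factor. -/

/-- The Fourier integral `∫ tanh (w x + b) exp (-i k x) dx`, in the sense of distributions, at a
frequency `k ≠ 0`. -/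
noncomputable def tanhHat (k w b : ℝ) : ℂ :=
  -(Real.pi * Complex.I) * Complex.exp ((k * b / w : ℝ) * Complex.I) /
    ((|w| * Real.sinh (Real.pi * k / (2 * w)) : ℝ) : ℂ)

theorem abs_mul_sinh_ne_zero {k w : ℝ} (hk : k ≠ 0) (hw : w ≠ 0) :
    |w| * Real.sinh (Real.pi * k / (2 * w)) ≠ 0 := by
  refine mul_ne_zero (abs_ne_zero.2 hw) ?_
  rw [Ne, Real.sinh_eq_zero]
  positivity

/-- The derivative of `x ↦ tanh (w x + b)`. -/
noncomputable def tanhDeriv (w b x : ℝ) : ℝ := w * (Real.cosh (w * x + b) ^ 2)⁻¹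

theorem continuous_tanhDeriv (w b : ℝ) : Continuous (tanhDeriv w b) := by
  unfold tanhDeriv
  refine continuous_const.mul (Continuous.inv₀ ?_ fun x => (pow_pos (Real.cosh_pos _) 2).ne')
  exact (Real.continuous_cosh.comp (by fun_prop)).pow 2

theorem abs_tanhDeriv_le (w b x : ℝ) : |tanhDeriv w b x| ≤ |w| := by
  unfold tanhDeriv
  rw [abs_mul]
  refine mul_le_of_le_one_right (abs_nonneg _) ?_
  rw [abs_inv]
  refine inv_le_one_of_one_le₀ ?_
  rw [abs_of_nonneg (sq_nonneg _)]
  exact one_le_pow₀ (Real.one_le_cosh _)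

theorem hasDerivAt_tanh_affine (w b x : ℝ) :
    HasDerivAt (fun x => Real.tanh (w * x + b)) (tanhDeriv w b x) x := by
  have h := ((hasDerivAt_id x).const_mul w).add_const b
  refine ((hasDerivAt_tanh_real (w * x + b)).comp x h).congr_deriv ?_
  simp [tanhDeriv, mul_comm]

theorem integrable_tanhDeriv {w : ℝ} (hw : w ≠ 0) (b : ℝ) : Integrable (tanhDeriv w b) :=
  ((integrable_inv_cosh_sq.comp_add_right b).comp_mul_left' hw).const_mul w

/-- This justifies the formula for `tanhHat`: differentiation multiplies the transform by `ik`, and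
the derivative, unlike tanh itself, is integrable. The substitution `u = w x + b` produces the wave
from `b` and the `|w|` from the Jacobian. -/
theorem integral_exp_mul_tanhDeriv {k w : ℝ} (hk : k ≠ 0) (hw : w ≠ 0) (b : ℝ) :
    ∫ x : ℝ, Complex.exp (-(k * x) * Complex.I) * (tanhDeriv w b x : ℂ) =
      k * Complex.I * tanhHat k w b := by
  have hkw : k / w ≠ 0 := div_ne_zero hk hw
  set F : ℝ → ℂ := fun u => Complex.exp ((k * b / w : ℝ) * Complex.I) * w *
    (Complex.exp (-((k / w : ℝ) * u) * Complex.I) * (((Real.cosh u ^ 2)⁻¹ : ℝ) : ℂ)) with hF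
  have h := Measure.integral_comp_mul_left (fun y => F (y + b)) w
  have hFi : ∫ u, F u = Complex.exp ((k * b / w : ℝ) * Complex.I) * w *
      ((Real.pi * (k / w) / Real.sinh (Real.pi * (k / w) / 2) : ℝ) : ℂ) := by
    rw [hF, integral_const_mul, integral_exp_mul_inv_cosh_sq hkw]
  rw [integral_add_right_eq_self F b, hFi] at h
  calc _ = _ := ?_
    _ = _ := h
    _ = _ := ?_
  · refine integral_congr_ae (Eventually.of_forall fun x => ?_)
    simp only [tanhDeriv, hF]
    have e : Complex.exp (-(k * x) * Complex.I) = Complex.exp ((k * b / w : ℝ) * Complex.I) *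
        Complex.exp (-((k / w : ℝ) * ((w * x + b : ℝ) : ℂ)) * Complex.I) := by
      rw [← Complex.exp_add]
      congr 1
      have : (w : ℂ) ≠ 0 := by exact_mod_cast hw
      push_cast
      field_simp
      ring
    rw [e]
    push_cast
    ring
  · have hs := abs_mul_sinh_ne_zero hk hw
    have hs' := (mul_ne_zero_iff.1 hs).2
    rw [tanhHat, Complex.real_smul, show Real.pi * (k / w) / 2 = Real.pi * k / (2 * w) by ring,
      abs_inv]
    have h1 : ((Real.sinh (Real.pi * k / (2 * w)) : ℝ) : ℂ) ≠ 0 := by exact_mod_cast hs'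
    have h2 : ((|w| : ℝ) : ℂ) ≠ 0 := by exact_mod_cast abs_ne_zero.2 hw
    have h3 : (w : ℂ) ≠ 0 := by exact_mod_cast hw
    generalize Real.sinh (Real.pi * k / (2 * w)) = S at *
    generalize Complex.exp ((k * b / w : ℝ) * Complex.I) = E
    push_cast at *
    field_simp
    rw [Complex.I_sq]
    ring

theorem continuousAt_tanhHat {k w : ℝ} (hk : k ≠ 0) (hw : w ≠ 0) (b : ℝ) :
    ContinuousAt (fun k => tanhHat k w b) k := by
  unfold tanhHat
  refine ContinuousAt.div (by fun_prop) ?_ (by exact_mod_cast abs_mul_sinh_ne_zero hk hw)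
  refine Complex.continuous_ofReal.continuousAt.comp ?_
  exact continuousAt_const.mul (Real.continuous_sinh.continuousAt.comp (by fun_prop))

/-! ### The spectrum of the network off the coordinate axes. -/

/-- The `i`-th unit vector of the plane. -/
noncomputable abbrev unitVec (i : Fin 2) : Plane := EuclideanSpace.single i 1

theorem hasLineDerivAt_comp_coord {u : ℝ → ℝ} {u' : ℝ} {p : Plane} (i : Fin 2)
    (h : HasDerivAt u u' (p i)) (c : ℂ) :
    HasLineDerivAt ℝ (fun q : Plane => c * (u (q i) : ℂ)) (c * (u' : ℂ)) p (unitVec i) := by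
  have h1 : HasDerivAt (fun t => c * (u (p i + t) : ℂ)) (c * (u' : ℂ)) 0 :=
    (HasDerivAt.comp_const_add (p i) 0 (by simpa using h)).ofReal_comp.const_mul c
  unfold HasLineDerivAt
  simpa using h1

/-- Integration by parts against a Schwartz function. -/
theorem integral_mul_lineDerivOp_schwartz {f f' : Plane → ℂ} {v : Plane} {C : ℝ}
    (hf : Continuous f) (hf' : Continuous f') (hC : ∀ p, ‖f p‖ ≤ C) (hC' : ∀ p, ‖f' p‖ ≤ C)
    (hd : ∀ p, HasLineDerivAt ℝ f (f' p) p v) (h : 𝓢(Plane, ℂ)) :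
    ∫ p, f p * (LineDeriv.lineDerivOp v h) p = -∫ p, f' p * h p := by
  refine integral_bilinear_hasLineDerivAt_right_eq_neg_left_of_integrable
    (B := ContinuousLinearMap.mul ℝ ℂ) (v := v) ?_ ?_ ?_ (fun p _ => hd p) fun p _ => ?_
  · exact h.integrable.bdd_mul hf'.aestronglyMeasurable (Eventually.of_forall hC')
  · exact (LineDeriv.lineDerivOp v h).integrable.bdd_mul hf.aestronglyMeasurable
      (Eventually.of_forall hC)
  · exact h.integrable.bdd_mul hf.aestronglyMeasurable (Eventually.of_forall hC)
  · rw [SchwartzMap.lineDerivOp_apply_eq_fderiv]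
    exact (h.hasFDerivAt p).hasLineDerivAt v

/-- Two integrations by parts, whose signs cancel. For nonzero weights the product of the tanh
derivatives is integrable on the plane, so its Fourier transform is an honest integral. -/
theorem integral_tanh_mul_lineDerivOp (w₀ b₀ w₁ b₁ : ℝ) (h : 𝓢(Plane, ℂ)) :
    ∫ p : Plane, ((Real.tanh (w₀ * p 0 + b₀) : ℂ) * (Real.tanh (w₁ * p 1 + b₁) : ℂ)) *
        (LineDeriv.lineDerivOp (unitVec 0) (LineDeriv.lineDerivOp (unitVec 1) h)) p =
      ∫ p : Plane, ((tanhDeriv w₀ b₀ (p 0) : ℂ) * (tanhDeriv w₁ b₁ (p 1) : ℂ)) * h p := by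
  have ht := continuous_tanh_real
  have hc := continuous_tanhDeriv
  have ht1 : ∀ w b x : ℝ, ‖(Real.tanh (w * x + b) : ℂ)‖ ≤ 1 := fun w b x => by
    rw [Complex.norm_real]
    exact abs_tanh_real_le_one _
  have hd1 : ∀ w b x : ℝ, ‖(tanhDeriv w b x : ℂ)‖ ≤ |w| := fun w b x => by
    rw [Complex.norm_real]
    exact abs_tanhDeriv_le w b x
  have c0 : ∀ i : Fin 2, Continuous fun p : Plane => p i := fun i => by fun_prop
  have C1 : ∀ (w b : ℝ) (i : Fin 2), Continuous fun p : Plane => (Real.tanh (w * p i + b) : ℂ) :=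
    fun w b i => Complex.continuous_ofReal.comp
      (ht.comp ((continuous_const.mul (c0 i)).add continuous_const))
  have C2 : ∀ (w b : ℝ) (i : Fin 2), Continuous fun p : Plane => (tanhDeriv w b (p i) : ℂ) :=
    fun w b i => Complex.continuous_ofReal.comp ((hc w b).comp (c0 i))
  rw [integral_mul_lineDerivOp_schwartz
    (f := fun p => (Real.tanh (w₀ * p 0 + b₀) : ℂ) * (Real.tanh (w₁ * p 1 + b₁) : ℂ))
    (f' := fun p => (tanhDeriv w₀ b₀ (p 0) : ℂ) * (Real.tanh (w₁ * p 1 + b₁) : ℂ))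
    (C := max 1 |w₀|) ((C1 w₀ b₀ 0).mul (C1 w₁ b₁ 1)) ((C2 w₀ b₀ 0).mul (C1 w₁ b₁ 1)),
    integral_mul_lineDerivOp_schwartz
    (f := fun p => (tanhDeriv w₀ b₀ (p 0) : ℂ) * (Real.tanh (w₁ * p 1 + b₁) : ℂ))
    (f' := fun p => (tanhDeriv w₀ b₀ (p 0) : ℂ) * (tanhDeriv w₁ b₁ (p 1) : ℂ))
    (C := max |w₀| (|w₀| * |w₁|)) ((C2 w₀ b₀ 0).mul (C1 w₁ b₁ 1)) ((C2 w₀ b₀ 0).mul (C2 w₁ b₁ 1)),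
    neg_neg]
  · intro p
    refine le_max_of_le_left ?_
    rw [norm_mul]
    exact (mul_le_of_le_one_right (norm_nonneg _) (ht1 _ _ _)).trans (hd1 _ _ _)
  · intro p
    refine le_max_of_le_right ?_
    rw [norm_mul]
    exact mul_le_mul (hd1 _ _ _) (hd1 _ _ _) (norm_nonneg _) (abs_nonneg _)
  · intro p
    have := hasLineDerivAt_comp_coord (p := p) 1 (hasDerivAt_tanh_affine w₁ b₁ (p 1))
      (tanhDeriv w₀ b₀ (p 0) : ℂ)
    unfold HasLineDerivAt at this ⊢
    simpa using this
  · intro p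
    refine le_max_of_le_left ?_
    rw [norm_mul]
    exact mul_le_one₀ (ht1 _ _ _) (norm_nonneg _) (ht1 _ _ _)
  · intro p
    refine le_max_of_le_right ?_
    rw [norm_mul]
    exact (mul_le_of_le_one_right (norm_nonneg _) (ht1 _ _ _)).trans (hd1 _ _ _)
  · intro p
    have := hasLineDerivAt_comp_coord (p := p) 0 (hasDerivAt_tanh_affine w₀ b₀ (p 0))
      (Real.tanh (w₁ * p 1 + b₁) : ℂ)
    unfold HasLineDerivAt at this ⊢
    simpa [mul_comm] using this

theorem integrable_prod_coord {g₀ g₁ : ℝ → ℂ} (h₀ : Integrable g₀) (h₁ : Integrable g₁) :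
    Integrable fun p : Plane => g₀ (p 0) * g₁ (p 1) := by
  have h := Integrable.fintype_prod (𝕜 := ℂ) (ι := Fin 2) (E := ℝ)
    (μ := fun _ => volume) (f := ![g₀, g₁]) (by
      intro i
      fin_cases i
      · exact h₀
      · exact h₁)
  have h2 := ((EuclideanSpace.volume_preserving_symm_measurableEquiv_toLp
    (Fin 2)).integrable_comp_emb (MeasurableEquiv.measurableEmbedding _)).2 h
  simpa [Function.comp_def] using h2

theorem integral_prod_coord (g₀ g₁ : ℝ → ℂ) :
    ∫ p : Plane, g₀ (p 0) * g₁ (p 1) = (∫ x, g₀ x) * ∫ x, g₁ x := by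
  have h := integral_fin_nat_prod_eq_prod (𝕜 := ℂ) (n := 2) (E := fun _ => ℝ)
    (μ := fun _ => volume) ![g₀, g₁]
  have h2 := (EuclideanSpace.volume_preserving_symm_measurableEquiv_toLp
    (Fin 2)).integral_comp (MeasurableEquiv.measurableEmbedding _)
    (fun x : Fin 2 → ℝ => ∏ i, (![g₀, g₁] : Fin 2 → ℝ → ℂ) i (x i))
  rw [volume_pi, h] at h2
  simpa using h2

theorem fourier_prod_coord (g₀ g₁ : ℝ → ℂ) (ξ : Plane) :
    𝓕 (fun p : Plane => g₀ (p 0) * g₁ (p 1)) ξ =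
      (∫ x : ℝ, Complex.exp (-((2 * Real.pi * ξ 0 : ℝ) * x) * Complex.I) * g₀ x) *
      ∫ x : ℝ, Complex.exp (-((2 * Real.pi * ξ 1 : ℝ) * x) * Complex.I) * g₁ x := by
  rw [← integral_prod_coord, Real.fourier_eq']
  refine integral_congr_ae (Eventually.of_forall fun p => ?_)
  simp only [smul_eq_mul, PiLp.inner_apply, Fin.sum_univ_two, RCLike.inner_apply, conj_trivial]
  have : Complex.exp (((-2 * Real.pi * (ξ 0 * p 0 + ξ 1 * p 1) : ℝ) : ℂ) * Complex.I) =
      Complex.exp (-((2 * Real.pi * ξ 0 : ℝ) * (p 0 : ℂ)) * Complex.I) *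
      Complex.exp (-((2 * Real.pi * ξ 1 : ℝ) * (p 1 : ℂ)) * Complex.I) := by
    rw [← Complex.exp_add]
    congr 1
    push_cast
    ring
  rw [this]
  ring

theorem integral_mul_fourier_schwartz {G : Plane → ℂ} (hG : Integrable G) (ψ : 𝓢(Plane, ℂ)) :
    ∫ p, G p * (𝓕 ψ) p = ∫ ξ, 𝓕 G ξ * ψ ξ := by
  have h := VectorFourier.integral_fourierIntegral_smul_eq_flip (L := innerₗ Plane)
    (μ := volume) (ν := volume) Real.continuous_fourierChar continuous_inner hG ψ.integrable
  simp only [flip_innerₗ, smul_eq_mul] at h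
  exact h.symm

/-- Off the coordinate axes a compactly supported Schwartz function can be divided by the product
of the coordinates. -/
theorem exists_schwartz_div {φ : 𝓢(Plane, ℂ)} (hφ : HasCompactSupport φ)
    (hs : tsupport φ ⊆ {ξ | ξ 0 ≠ 0 ∧ ξ 1 ≠ 0}) :
    ∃ ψ : 𝓢(Plane, ℂ), ∀ ξ, ψ ξ = φ ξ * ((ξ 0 : ℂ) * (ξ 1 : ℂ))⁻¹ := by
  have hc : HasCompactSupport fun ξ => φ ξ * ((ξ 0 : ℂ) * (ξ 1 : ℂ))⁻¹ := hφ.mul_right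
  have hd : ContDiff ℝ (⊤ : ℕ∞) fun ξ => φ ξ * ((ξ 0 : ℂ) * (ξ 1 : ℂ))⁻¹ := by
    refine contDiff_iff_contDiffAt.2 fun ξ => ?_
    by_cases hξ : ξ ∈ tsupport φ
    swap
    -- Away from the support the quotient vanishes in a neighbourhood, so the axes cause no
    -- singularity.
    · refine contDiffAt_const (c := (0 : ℂ)) |>.congr_of_eventuallyEq ?_
      filter_upwards [notMem_tsupport_iff_eventuallyEq.1 hξ] with η hη
      simp [hη]
    obtain ⟨h0, h1⟩ := hs hξ
    have hcoord : ∀ i : Fin 2, ContDiffAt ℝ (⊤ : ℕ∞) (fun ξ : Plane => (ξ i : ℂ)) ξ := fun i =>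
      (Complex.ofRealCLM.contDiff.comp
        (EuclideanSpace.proj i : Plane →L[ℝ] ℝ).contDiff).contDiffAt
    refine (φ.smooth _).contDiffAt.mul (((hcoord 0).mul (hcoord 1)).inv ?_)
    exact mul_ne_zero (by exact_mod_cast h0) (by exact_mod_cast h1)
  exact ⟨hc.toSchwartzMap hd, fun ξ => rfl⟩

/-- Each derivative of a Fourier transform brings down a factor `-2πi ξ_i`; the two minus signs
cancel. -/
theorem lineDerivOp_lineDerivOp_fourier (ψ : 𝓢(Plane, ℂ)) {φ : 𝓢(Plane, ℂ)}
    (h : ∀ ξ, φ ξ = (2 * Real.pi * Complex.I) ^ 2 * ((ξ 0 : ℂ) * (ξ 1 : ℂ)) * ψ ξ) :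
    LineDeriv.lineDerivOp (unitVec 0) (LineDeriv.lineDerivOp (unitVec 1) (𝓕 ψ)) = 𝓕 φ := by
  rw [SchwartzMap.lineDerivOp_fourier_eq, SchwartzMap.lineDerivOp_fourier_eq]
  congr 1
  ext ξ
  have ht : ∀ i : Fin 2, Function.HasTemperateGrowth fun x : Plane => inner ℝ x (unitVec i) :=
    fun i => by fun_prop
  rw [smul_apply, SchwartzMap.smulLeftCLM_apply_apply (ht 0), smul_apply,
    SchwartzMap.smulLeftCLM_apply_apply (ht 1), h]
  simp only [EuclideanSpace.inner_single_right, smul_eq_mul, Complex.real_smul, one_mul,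
    conj_trivial]
  ring

/-- Dividing `φ` by `(2πi)² ξ₀ ξ₁` exhibits `𝓕 φ` as a mixed derivative. Moved onto the tanh
factors, that derivative makes them integrable, and then the transform passes across the pairing.
The factors `ik` of the two one-dimensional transforms cancel the division. -/
theorem integral_fourier_mul_tanh {w₀ w₁ : ℝ} (h₀ : w₀ ≠ 0) (h₁ : w₁ ≠ 0) (b₀ b₁ : ℝ)
    {φ : 𝓢(Plane, ℂ)} (hφ : HasCompactSupport φ)
    (hs : tsupport φ ⊆ {ξ | ξ 0 ≠ 0 ∧ ξ 1 ≠ 0}) :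
    ∫ p : Plane, ((Real.tanh (w₀ * p 0 + b₀) : ℂ) * (Real.tanh (w₁ * p 1 + b₁) : ℂ)) * (𝓕 φ) p =
      ∫ ξ : Plane, φ ξ *
        (tanhHat (2 * Real.pi * ξ 0) w₀ b₀ * tanhHat (2 * Real.pi * ξ 1) w₁ b₁) := by
  obtain ⟨ψ₀, hψ₀⟩ := exists_schwartz_div hφ hs
  have hpi : (2 * Real.pi * Complex.I) ^ 2 ≠ 0 :=
    pow_ne_zero _ Complex.two_pi_I_ne_zero
  set ψ : 𝓢(Plane, ℂ) := ((2 * Real.pi * Complex.I) ^ 2)⁻¹ • ψ₀ with hψ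
  have hψa : ∀ ξ, ψ ξ = ((2 * Real.pi * Complex.I) ^ 2)⁻¹ *
      (φ ξ * ((ξ 0 : ℂ) * (ξ 1 : ℂ))⁻¹) := fun ξ => by
    rw [hψ, smul_apply, hψ₀, smul_eq_mul]
  have hφψ : ∀ ξ : Plane,
      φ ξ = (2 * Real.pi * Complex.I) ^ 2 * ((ξ 0 : ℂ) * (ξ 1 : ℂ)) * ψ ξ := fun ξ => by
    rw [hψa]
    by_cases hξ : φ ξ = 0
    · simp [hξ]
    · obtain ⟨k0, k1⟩ := hs (subset_tsupport _ (Function.mem_support.2 hξ))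
      have k : (ξ 0 : ℂ) * (ξ 1 : ℂ) ≠ 0 :=
        mul_ne_zero (by exact_mod_cast k0) (by exact_mod_cast k1)
      generalize (ξ 0 : ℂ) * (ξ 1 : ℂ) = z at *
      generalize (2 * Real.pi * Complex.I) ^ 2 = z' at *
      field_simp
  have hI : ∀ {w : ℝ}, w ≠ 0 → ∀ b, Integrable fun x => (tanhDeriv w b x : ℂ) :=
    fun hw b => (integrable_tanhDeriv hw b).ofReal
  rw [← lineDerivOp_lineDerivOp_fourier ψ hφψ, integral_tanh_mul_lineDerivOp,
    integral_mul_fourier_schwartz (integrable_prod_coord (hI h₀ b₀) (hI h₁ b₁))]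
  refine integral_congr_ae (Eventually.of_forall fun ξ => ?_)
  simp only []
  by_cases hξ : φ ξ = 0
  · simp [hψa, hξ]
  · obtain ⟨k0, k1⟩ := hs (subset_tsupport _ (Function.mem_support.2 hξ))
    rw [fourier_prod_coord (fun x => (tanhDeriv w₀ b₀ x : ℂ)) (fun x => (tanhDeriv w₁ b₁ x : ℂ)),
      integral_exp_mul_tanhDeriv (by positivity) h₀,
      integral_exp_mul_tanhDeriv (by positivity) h₁, hφψ ξ]
    push_cast
    ring

theorem integrable_schwartz_mul_of_continuousOn {g : Plane → ℂ} {U : Set Plane}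
    (hg : ContinuousOn g U) {φ : 𝓢(Plane, ℂ)} (hφ : HasCompactSupport φ) (hs : tsupport φ ⊆ U) :
    Integrable fun ξ => φ ξ * g ξ := by
  have h0 : IntegrableOn (fun ξ => φ ξ * g ξ) (tsupport φ) :=
    (φ.continuous.continuousOn.mul (hg.mono hs)).integrableOn_compact hφ
  refine (integrableOn_iff_integrable_of_support_subset fun ξ hξ => subset_tsupport _ ?_).1 h0
  intro h1
  exact hξ (by simp [h1])

theorem continuousOn_tanhHat_mul {w₀ w₁ : ℝ} (h₀ : w₀ ≠ 0) (h₁ : w₁ ≠ 0) (b₀ b₁ : ℝ) :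
    ContinuousOn (fun ξ : Plane => tanhHat (2 * Real.pi * ξ 0) w₀ b₀ *
      tanhHat (2 * Real.pi * ξ 1) w₁ b₁) {ξ | ξ 0 ≠ 0 ∧ ξ 1 ≠ 0} := by
  intro ξ hξ
  refine ContinuousAt.continuousWithinAt ?_
  have key : ∀ (i : Fin 2) (w b : ℝ), ξ i ≠ 0 → w ≠ 0 →
      ContinuousAt (fun ξ : Plane => tanhHat (2 * Real.pi * ξ i) w b) ξ := by
    intro i w b hi hw
    exact ContinuousAt.comp (f := fun ξ : Plane => 2 * Real.pi * ξ i)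
      (g := fun k => tanhHat k w b)
      (continuousAt_tanhHat (by positivity) hw b) (by fun_prop)
  exact (key 0 _ _ hξ.1 h₀).mul (key 1 _ _ hξ.2 h₁)

theorem integrable_tanh_mul_schwartz (w₀ b₀ w₁ b₁ : ℝ) (h : 𝓢(Plane, ℂ)) :
    Integrable fun p : Plane =>
      ((Real.tanh (w₀ * p 0 + b₀) : ℂ) * (Real.tanh (w₁ * p 1 + b₁) : ℂ)) * h p := by
  refine h.integrable.bdd_mul (c := 1) (Continuous.aestronglyMeasurable ?_)
    (Eventually.of_forall fun p => ?_)
  · have ht := continuous_tanh_real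
    have c0 : ∀ i : Fin 2, Continuous fun p : Plane => p i := fun i => by fun_prop
    exact (Complex.continuous_ofReal.comp
      (ht.comp ((continuous_const.mul (c0 0)).add continuous_const))).mul
      (Complex.continuous_ofReal.comp
      (ht.comp ((continuous_const.mul (c0 1)).add continuous_const)))
  · rw [norm_mul, Complex.norm_real, Complex.norm_real]
    exact mul_le_one₀ (abs_tanh_real_le_one _) (norm_nonneg _) (abs_tanh_real_le_one _)

theorem tnnDist_apply {r : ℕ} (Θ : Params r) (φ : 𝓢(Plane, ℂ)) :
    tnnDist Θ φ = ∫ p : Plane, φ p * (tnn Θ p : ℂ) := by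
  unfold tnnDist
  rw [Lp.toTemperedDistribution_apply]
  refine integral_congr_ae ?_
  filter_upwards [(memLp_tnn Θ).coeFn_toLp] with p hp
  rw [hp, smul_eq_mul]

/-- The Fourier transform of the network, as a continuous function off the coordinate axes. -/
theorem hasValueAt_fourier_tnnDist {r : ℕ} {Θ : Params r}
    (hw : ∀ j, Θ j .weightX ≠ 0 ∧ Θ j .weightY ≠ 0) {ξ : Plane} (h0 : ξ 0 ≠ 0) (h1 : ξ 1 ≠ 0) :
    HasValueAt (𝓕 (tnnDist Θ)) ξ (∑ j, Θ j .coeff *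
      (tanhHat (2 * Real.pi * ξ 0) (Θ j .weightX) (Θ j .biasX) *
        tanhHat (2 * Real.pi * ξ 1) (Θ j .weightY) (Θ j .biasY))) := by
  have hcont : ContinuousOn (fun ξ : Plane => ∑ j, (Θ j .coeff : ℂ) *
      (tanhHat (2 * Real.pi * ξ 0) (Θ j .weightX) (Θ j .biasX) *
        tanhHat (2 * Real.pi * ξ 1) (Θ j .weightY) (Θ j .biasY)))
      {ξ | ξ 0 ≠ 0 ∧ ξ 1 ≠ 0} := by
    exact continuousOn_finsetSum _ fun j _ => continuousOn_const.mul
      (continuousOn_tanhHat_mul (hw j).1 (hw j).2 _ _)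
  refine ⟨{ξ | ξ 0 ≠ 0 ∧ ξ 1 ≠ 0}, _, ?_, ⟨h0, h1⟩, hcont, rfl, ?_⟩
  · have c0 : ∀ i : Fin 2, Continuous fun p : Plane => p i := fun i => by fun_prop
    exact (isOpen_ne_fun (c0 0) continuous_const).inter (isOpen_ne_fun (c0 1) continuous_const)
  intro φ hφ hs
  rw [TemperedDistribution.fourier_apply, tnnDist_apply]
  have hL : ∀ p, (𝓕 φ) p * (tnn Θ p : ℂ) = ∑ j, (Θ j .coeff : ℂ) *
      (((Real.tanh (Θ j .weightX * p 0 + Θ j .biasX) : ℂ) *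
        (Real.tanh (Θ j .weightY * p 1 + Θ j .biasY) : ℂ)) * (𝓕 φ) p) := fun p => by
    unfold tnn
    push_cast
    rw [Finset.mul_sum]
    exact Finset.sum_congr rfl fun j _ => by ring
  have hR : ∀ ξ : Plane, φ ξ * ∑ j, (Θ j .coeff : ℂ) *
      (tanhHat (2 * Real.pi * ξ 0) (Θ j .weightX) (Θ j .biasX) *
        tanhHat (2 * Real.pi * ξ 1) (Θ j .weightY) (Θ j .biasY)) =
      ∑ j, (Θ j .coeff : ℂ) * (φ ξ *
      (tanhHat (2 * Real.pi * ξ 0) (Θ j .weightX) (Θ j .biasX) *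
        tanhHat (2 * Real.pi * ξ 1) (Θ j .weightY) (Θ j .biasY))) := fun ξ => by
    rw [Finset.mul_sum]
    exact Finset.sum_congr rfl fun j _ => by ring
  simp_rw [hL, hR]
  rw [integral_finsetSum, integral_finsetSum]
  · refine Finset.sum_congr rfl fun j _ => ?_
    rw [integral_const_mul, integral_const_mul,
      integral_fourier_mul_tanh (hw j).1 (hw j).2 _ _ hφ hs]
  · exact fun j _ => (integrable_schwartz_mul_of_continuousOn
      (continuousOn_tanhHat_mul (hw j).1 (hw j).2 _ _) hφ hs).const_mul _
  · exact fun j _ => (integrable_tanh_mul_schwartz _ _ _ _ _).const_mul _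

/-! ### The gradient of the spectral loss. -/

/-- The contribution of a neuron with parameters `θ` to the spectrum at `k`. -/
noncomputable def neuronHat (θ : ParamKind → ℝ) (k : Plane) : ℂ :=
  ((2 * Real.pi)⁻¹ : ℝ) * (θ .coeff * (tanhHat (k 0) (θ .weightX) (θ .biasX) *
    tanhHat (k 1) (θ .weightY) (θ .biasY)))

theorem hasValueAt_fourier_tnnDist_smul {r : ℕ} {Θ : Params r}
    (hw : ∀ j, Θ j .weightX ≠ 0 ∧ Θ j .weightY ≠ 0) {k : Plane} (h0 : k 0 ≠ 0) (h1 : k 1 ≠ 0) :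
    HasValueAt (𝓕 (tnnDist Θ)) ((2 * Real.pi)⁻¹ • k) (∑ j, Θ j .coeff *
      (tanhHat (k 0) (Θ j .weightX) (Θ j .biasX) *
        tanhHat (k 1) (Θ j .weightY) (Θ j .biasY))) := by
  have hpi : (2 * Real.pi) ≠ 0 := by positivity
  have h := hasValueAt_fourier_tnnDist hw (ξ := (2 * Real.pi)⁻¹ • k)
    (by simpa using h0) (by simpa using h1)
  have e : ∀ i, 2 * Real.pi * ((2 * Real.pi)⁻¹ • k) i = k i := fun i => by
    rw [PiLp.smul_apply, smul_eq_mul, mul_inv_cancel_left₀ hpi]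
  rwa [e, e] at h

theorem spectrumAt_tnnDist {r : ℕ} {Θ : Params r}
    (hw : ∀ j, Θ j .weightX ≠ 0 ∧ Θ j .weightY ≠ 0) {k : Plane} (h0 : k 0 ≠ 0) (h1 : k 1 ≠ 0) :
    spectrumAt (tnnDist Θ) k = ∑ j, neuronHat (Θ j) k := by
  unfold spectrumAt neuronHat
  rw [(hasValueAt_fourier_tnnDist_smul hw h0 h1).valueAt_eq, Finset.mul_sum]

theorem spectralError_eq {r : ℕ} (f : 𝓢'(Plane, ℂ)) {Θ : Params r}
    (hw : ∀ j, Θ j .weightX ≠ 0 ∧ Θ j .weightY ≠ 0) {k : Plane} (h0 : k 0 ≠ 0) (h1 : k 1 ≠ 0) :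
    spectralError f Θ k = ∑ j, neuronHat (Θ j) k - spectrumAt f k := by
  unfold spectralError
  rw [spectrumAt_tnnDist hw h0 h1]

/-- Only one summand of the spectrum changes, so differentiating the loss in a parameter of neuron
`j` reduces to differentiating `neuronHat`. -/
theorem spectralError_update {r : ℕ} (f : 𝓢'(Plane, ℂ)) {Θ : Params r}
    (hw : ∀ j, Θ j .weightX ≠ 0 ∧ Θ j .weightY ≠ 0) {k : Plane} (h0 : k 0 ≠ 0) (h1 : k 1 ≠ 0)
    (j : Fin r) {θ : ParamKind → ℝ} (hθ : θ .weightX ≠ 0 ∧ θ .weightY ≠ 0) :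
    spectralError f (Function.update Θ j θ) k =
      spectralError f Θ k - neuronHat (Θ j) k + neuronHat θ k := by
  have hw' : ∀ i, Function.update Θ j θ i .weightX ≠ 0 ∧ Function.update Θ j θ i .weightY ≠ 0 := by
    intro i
    by_cases hi : i = j
    · subst hi
      simpa using hθ
    · simpa [hi] using hw i
  rw [spectralError_eq f hw' h0 h1, spectralError_eq f hw h0 h1,
    ← Finset.add_sum_erase _ _ (Finset.mem_univ j),
    ← Finset.add_sum_erase _ (fun j => neuronHat (Θ j) k) (Finset.mem_univ j)]
  have : ∑ x ∈ Finset.univ.erase j, neuronHat (Function.update Θ j θ x) k =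
      ∑ x ∈ Finset.univ.erase j, neuronHat (Θ x) k :=
    Finset.sum_congr rfl fun i hi => by rw [Function.update_of_ne (Finset.ne_of_mem_erase hi)]
  rw [this, Function.update_self]
  ring

/-- The modulus of `tanhHat`, with a sign. -/
noncomputable def tanhAmp (k w : ℝ) : ℝ := Real.pi / (|w| * Real.sinh (Real.pi * k / (2 * w)))

theorem tanhHat_eq (k w b : ℝ) :
    tanhHat k w b = tanhAmp k w * (-Complex.I * Complex.exp ((k * b / w : ℝ) * Complex.I)) := by
  unfold tanhHat tanhAmp
  push_cast
  ring

theorem hasDerivAt_tanhHat_bias (k w b : ℝ) :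
    HasDerivAt (fun b => tanhHat k w b) (tanhHat k w b * ((k / w : ℝ) * Complex.I)) b := by
  simp_rw [tanhHat_eq]
  have h1 : HasDerivAt (fun b : ℝ => k * b / w) (k / w) b := by
    simpa using ((hasDerivAt_id b).const_mul k).div_const w
  have h2 := ((h1.ofReal_comp.mul_const Complex.I).cexp.const_mul (-Complex.I)).const_mul
    (tanhAmp k w : ℂ)
  exact h2.congr_deriv (by ring)

/-- The logarithmic derivative of `tanhHat` with respect to the weight, divided by `k / w²`. -/
noncomputable def weightPhase (k w b : ℝ) : ℂ :=
  ((Real.pi / 2 * (Real.cosh (Real.pi * k / (2 * w)) / Real.sinh (Real.pi * k / (2 * w)))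
    - w / k : ℝ) : ℂ) - b * Complex.I

theorem hasDerivAt_tanhAmp {k w : ℝ} (hk : k ≠ 0) (hw : w ≠ 0) :
    HasDerivAt (fun w => tanhAmp k w) (tanhAmp k w * (k / w ^ 2 * (Real.pi / 2 *
      (Real.cosh (Real.pi * k / (2 * w)) / Real.sinh (Real.pi * k / (2 * w))) - w / k))) w := by
  have hne := abs_mul_sinh_ne_zero hk hw
  have hs := (mul_ne_zero_iff.1 hne).2
  have h1 : HasDerivAt (fun w : ℝ => Real.pi * k / (2 * w))
      (-(Real.pi * k / (2 * w ^ 2))) w := by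
    have h := ((hasDerivAt_id w).const_mul 2).inv (by simpa using hw)
    refine (h.const_mul (Real.pi * k)).congr_deriv ?_
    simp only [id]
    field_simp
  have h2 := (hasDerivAt_abs hw).mul h1.sinh
  have h3 := (h2.inv hne).const_mul Real.pi
  refine h3.congr_deriv ?_
  have hw' : |w| ≠ 0 := abs_ne_zero.2 hw
  -- With the sign written as a quotient, the claim is a rational identity in `w`, `|w|`, `sinh` and
  -- `cosh`.
  have hsgn : (SignType.sign w : ℝ) = |w| / w := by
    rw [eq_div_iff hw, sign_mul_self]
  rw [hsgn, tanhAmp]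
  simp only [Pi.mul_apply]
  generalize Real.sinh (Real.pi * k / (2 * w)) = S at *
  generalize Real.cosh (Real.pi * k / (2 * w)) = C at *
  generalize |w| = A at *
  field_simp
  ring

theorem hasDerivAt_tanhHat_weight {k w : ℝ} (hk : k ≠ 0) (hw : w ≠ 0) (b : ℝ) :
    HasDerivAt (fun w => tanhHat k w b)
      (tanhHat k w b * ((k / w ^ 2 : ℝ) * weightPhase k w b)) w := by
  simp_rw [tanhHat_eq]
  have h1 : HasDerivAt (fun w : ℝ => k * b / w) (-(k * b / w ^ 2)) w := by
    have h := (hasDerivAt_inv hw).const_mul (k * b)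
    refine h.congr_deriv ?_
    ring
  have h2 := ((h1.ofReal_comp.mul_const Complex.I).cexp.const_mul (-Complex.I))
  have h3 := (hasDerivAt_tanhAmp hk hw).ofReal_comp.mul h2
  refine h3.congr_deriv ?_
  unfold weightPhase
  push_cast
  ring

/-- The real factor of the derivative of `neuronHat` with respect to a parameter. -/
noncomputable def derivScale (θ : ParamKind → ℝ) (k : Plane) : ParamKind → ℝ
  | .coeff => 1
  | .weightX => θ .coeff * (k 0 / θ .weightX ^ 2)
  | .weightY => θ .coeff * (k 1 / θ .weightY ^ 2)
  | .biasX => θ .coeff * (k 0 / θ .weightX)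
  | .biasY => θ .coeff * (k 1 / θ .weightY)

/-- The complex factor of the derivative of `neuronHat` with respect to a parameter. -/
noncomputable def derivPhase (θ : ParamKind → ℝ) (k : Plane) : ParamKind → ℂ
  | .coeff => 1
  | .weightX => weightPhase (k 0) (θ .weightX) (θ .biasX)
  | .weightY => weightPhase (k 1) (θ .weightY) (θ .biasY)
  | .biasX => Complex.I
  | .biasY => Complex.I

/-- The modulus, with a sign, common to all derivatives of `neuronHat`. -/
noncomputable def neuronAmp (θ : ParamKind → ℝ) (k : Plane) : ℝ :=
  -((2 * Real.pi)⁻¹ * (tanhAmp (k 0) (θ .weightX) * tanhAmp (k 1) (θ .weightY)))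

/-- The rapidly oscillating factor of `neuronHat`. -/
noncomputable def neuronWave (θ : ParamKind → ℝ) (k : Plane) : ℂ :=
  Complex.exp ((k 0 * θ .biasX / θ .weightX + k 1 * θ .biasY / θ .weightY : ℝ) * Complex.I)

theorem norm_neuronWave (θ : ParamKind → ℝ) (k : Plane) : ‖neuronWave θ k‖ = 1 :=
  Complex.norm_exp_ofReal_mul_I _

theorem tanhHat_mul_tanhHat (θ : ParamKind → ℝ) (k : Plane) :
    (((2 * Real.pi)⁻¹ : ℝ) : ℂ) * (tanhHat (k 0) (θ .weightX) (θ .biasX) *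
      tanhHat (k 1) (θ .weightY) (θ .biasY)) = neuronAmp θ k * neuronWave θ k := by
  unfold neuronAmp neuronWave
  rw [tanhHat_eq, tanhHat_eq]
  push_cast
  rw [add_mul, Complex.exp_add]
  ring_nf
  rw [Complex.I_sq]
  ring

theorem neuronHat_eq (θ : ParamKind → ℝ) (k : Plane) :
    neuronHat θ k = θ .coeff * (neuronAmp θ k * neuronWave θ k) := by
  rw [← tanhHat_mul_tanhHat, neuronHat]
  ring

theorem hasDerivAt_neuronHat {θ : ParamKind → ℝ} (hθ : θ .weightX ≠ 0 ∧ θ .weightY ≠ 0)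
    {k : Plane} (h0 : k 0 ≠ 0) (h1 : k 1 ≠ 0) (l : ParamKind) :
    HasDerivAt (fun t => neuronHat (Function.update θ l t) k)
      ((neuronAmp θ k * derivScale θ k l : ℝ) • (neuronWave θ k * derivPhase θ k l)) (θ l) := by
  rw [Complex.real_smul]
  push_cast
  rw [show (neuronAmp θ k * derivScale θ k l * (neuronWave θ k * derivPhase θ k l) : ℂ) =
    neuronAmp θ k * neuronWave θ k * (derivScale θ k l * derivPhase θ k l) by ring, ← tanhHat_mul_tanhHat]
  cases l
  · have h := (((hasDerivAt_id (θ .coeff)).ofReal_comp.mul_const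
      (tanhHat (k 0) (θ .weightX) (θ .biasX) *
      tanhHat (k 1) (θ .weightY) (θ .biasY))).const_mul (((2 * Real.pi)⁻¹ : ℝ) : ℂ))
    simp only [neuronHat, Function.update_apply, reduceCtorEq, if_true, if_false]
    refine h.congr_deriv ?_
    simp only [derivScale, derivPhase]
    push_cast
    ring
  · have h := (((hasDerivAt_tanhHat_weight h0 hθ.1 (θ .biasX)).mul_const
      (tanhHat (k 1) (θ .weightY) (θ .biasY))).const_mul (θ .coeff : ℂ)).const_mul
      (((2 * Real.pi)⁻¹ : ℝ) : ℂ)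
    simp only [neuronHat, Function.update_apply, reduceCtorEq, if_true, if_false]
    refine h.congr_deriv ?_
    simp only [derivScale, derivPhase]
    push_cast
    ring
  · have h := (((hasDerivAt_tanhHat_weight h1 hθ.2 (θ .biasY)).const_mul
      (tanhHat (k 0) (θ .weightX) (θ .biasX))).const_mul (θ .coeff : ℂ)).const_mul
      (((2 * Real.pi)⁻¹ : ℝ) : ℂ)
    simp only [neuronHat, Function.update_apply, reduceCtorEq, if_true, if_false]
    refine h.congr_deriv ?_
    simp only [derivScale, derivPhase]
    push_cast
    ring
  · have h := (((hasDerivAt_tanhHat_bias (k 0) (θ .weightX) (θ .biasX)).mul_const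
      (tanhHat (k 1) (θ .weightY) (θ .biasY))).const_mul (θ .coeff : ℂ)).const_mul
      (((2 * Real.pi)⁻¹ : ℝ) : ℂ)
    simp only [neuronHat, Function.update_apply, reduceCtorEq, if_true, if_false]
    refine h.congr_deriv ?_
    simp only [derivScale, derivPhase]
    push_cast
    ring
  · have h := (((hasDerivAt_tanhHat_bias (k 1) (θ .weightY) (θ .biasY)).const_mul
      (tanhHat (k 0) (θ .weightX) (θ .biasX))).const_mul (θ .coeff : ℂ)).const_mul
      (((2 * Real.pi)⁻¹ : ℝ) : ℂ)
    simp only [neuronHat, Function.update_apply, reduceCtorEq, if_true, if_false]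
    refine h.congr_deriv ?_
    simp only [derivScale, derivPhase]
    push_cast
    ring

theorem eventually_update_weight_ne_zero {θ : ParamKind → ℝ}
    (hθ : θ .weightX ≠ 0 ∧ θ .weightY ≠ 0) (l : ParamKind) :
    ∀ᶠ t in 𝓝 (θ l), Function.update θ l t .weightX ≠ 0 ∧ Function.update θ l t .weightY ≠ 0 := by
  have hc : ∀ i, ContinuousAt (fun t => Function.update θ l t i) (θ l) := fun i =>
    (continuous_pi_iff.1 ((continuous_const (y := θ)).update l continuous_id) i).continuousAt
  have he : Function.update θ l (θ l) = θ := Function.update_eq_self l θ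
  exact ((hc _).eventually_ne (by rw [he]; exact hθ.1)).and
    ((hc _).eventually_ne (by rw [he]; exact hθ.2))

/-- The derivative of the spectral loss with respect to a parameter. -/
theorem hasDerivAt_lossAlong {r : ℕ} (f : 𝓢'(Plane, ℂ)) {Θ : Params r}
    (hw : ∀ j, Θ j .weightX ≠ 0 ∧ Θ j .weightY ≠ 0) {k : Plane} (h0 : k 0 ≠ 0) (h1 : k 1 ≠ 0)
    (j : Fin r) (l : ParamKind) :
    HasDerivAt (lossAlong f Θ k j l) (2 * (neuronAmp (Θ j) k * derivScale (Θ j) k l *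
      inner ℝ (spectralError f Θ k) (neuronWave (Θ j) k * derivPhase (Θ j) k l))) (Θ j l) := by
  have h := ((hasDerivAt_neuronHat (hw j) h0 h1 l).const_add
    (spectralError f Θ k - neuronHat (Θ j) k)).norm_sq
  rw [Function.update_eq_self, sub_add_cancel, inner_smul_right] at h
  -- The closed form of the spectrum needs nonzero weights, which persist only for parameter values
  -- near `Θ j l`.
  refine h.congr_of_eventuallyEq ?_
  filter_upwards [eventually_update_weight_ne_zero (hw j) l] with t ht
  rw [lossAlong, spectralLoss, spectralError_update f hw h0 h1 j ht]

/-! ### Decay of the amplitudes and convergence of the phases for small weights. -/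

/-- Expand `sinh ((q - p) x + p x)` and use `cosh y ≥ sinh y ≥ y` for `y = (q - p) x`. With `x = 1 /
|w|` this compares the amplitudes at two frequencies; the gain of a factor `|w|`, far weaker than
the true exponential one, suffices. -/
theorem mul_sinh_mul_le {p q x : ℝ} (hp : 0 ≤ p) (hpq : p ≤ q) (hx : 0 ≤ x) :
    (q - p) * x * Real.sinh (p * x) ≤ Real.sinh (q * x) := by
  have hy : 0 ≤ (q - p) * x := mul_nonneg (sub_nonneg.2 hpq) hx
  have h1 : 0 ≤ Real.sinh (p * x) := Real.sinh_nonneg_iff.2 (mul_nonneg hp hx)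
  have h2 : (q - p) * x ≤ Real.sinh ((q - p) * x) := Real.self_le_sinh_iff.2 hy
  have h3 := (Real.sinh_lt_cosh ((q - p) * x)).le
  have h4 := (Real.cosh_pos (p * x)).le
  rw [show q * x = (q - p) * x + p * x by ring, Real.sinh_add]
  nlinarith [mul_nonneg (hy.trans h2) h4, mul_le_mul_of_nonneg_right (h2.trans h3) h1]

/-- Doubling gives `sinh y = 2 sinh (y/2) cosh (y/2) ≥ 2 (y/2)²`. Quadratic growth is what beats the
`|w|` in the denominator of the amplitude. -/
theorem sq_div_two_le_sinh {y : ℝ} (hy : 0 ≤ y) : y ^ 2 / 2 ≤ Real.sinh y := by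
  have h := mul_sinh_mul_le (p := 1) (q := 2) (x := y / 2) zero_le_one one_le_two (by linarith)
  have h2 : y / 2 ≤ Real.sinh (y / 2) := Real.self_le_sinh_iff.2 (by linarith)
  rw [show 2 * (y / 2) = y by ring] at h
  have h3 := Real.sinh_add (y / 2) (y / 2)
  rw [add_halves] at h3
  have h4 := (Real.sinh_lt_cosh (y / 2)).le
  nlinarith

theorem abs_tanhAmp {k w : ℝ} (hk : 0 ≤ k) :
    |tanhAmp k w| = Real.pi / (|w| * Real.sinh (Real.pi * k / 2 * |w|⁻¹)) := by
  rw [tanhAmp, abs_div, abs_of_pos Real.pi_pos, abs_mul, abs_abs, Real.abs_sinh, abs_div,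
    abs_of_nonneg (mul_nonneg Real.pi_pos.le hk), abs_mul, abs_two]
  congr 3
  rw [← div_div, div_eq_mul_inv]

theorem abs_tanhAmp_le {k w : ℝ} (hk : 0 < k) (hw : w ≠ 0) :
    |tanhAmp k w| ≤ 8 / (Real.pi * k ^ 2) * |w| := by
  have hw' := abs_pos.2 hw
  have hpi := Real.pi_pos
  rw [abs_tanhAmp hk.le]
  have h := sq_div_two_le_sinh (y := Real.pi * k / 2 * |w|⁻¹) (by positivity)
  calc _ ≤ Real.pi / (|w| * ((Real.pi * k / 2 * |w|⁻¹) ^ 2 / 2)) := by gcongr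
    _ = _ := by
      field_simp
      ring

theorem abs_tanhAmp_le_mul {k k' w : ℝ} (hk : 0 < k) (hkk : k < k') (hw : w ≠ 0) :
    |tanhAmp k' w| ≤ 2 / (Real.pi * (k' - k)) * |w| * |tanhAmp k w| := by
  have hw' := abs_pos.2 hw
  have hpi := Real.pi_pos
  have hkk' : 0 < k' - k := sub_pos.2 hkk
  rw [abs_tanhAmp hk.le, abs_tanhAmp (hk.trans hkk).le]
  have h := mul_sinh_mul_le (p := Real.pi * k / 2) (q := Real.pi * k' / 2) (x := |w|⁻¹)
    (by positivity) (by gcongr) (by positivity)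
  have hs : 0 < Real.sinh (Real.pi * k / 2 * |w|⁻¹) := Real.sinh_pos_iff.2 (by positivity)
  calc _ ≤ Real.pi / (|w| * ((Real.pi * k' / 2 - Real.pi * k / 2) * |w|⁻¹ *
        Real.sinh (Real.pi * k / 2 * |w|⁻¹))) := by
        have : 0 < Real.pi * k' / 2 - Real.pi * k / 2 := by
          have := mul_pos hpi hkk'
          linarith
        gcongr
    _ = _ := by
      rw [show Real.pi * k' / 2 - Real.pi * k / 2 = Real.pi * (k' - k) / 2 by ring]
      field_simp

theorem tendsto_tanhAmp {k : ℝ} (hk : 0 < k) : Tendsto (tanhAmp k) (𝓝[≠] 0) (𝓝 0) := by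
  refine squeeze_zero_norm' (a := fun w => 8 / (Real.pi * k ^ 2) * |w|) ?_ ?_
  · filter_upwards [self_mem_nhdsWithin] with w hw
    exact abs_tanhAmp_le hk hw
  · refine Tendsto.mono_left ?_ nhdsWithin_le_nhds
    exact Continuous.tendsto' (by fun_prop) _ _ (by simp)

theorem isLittleO_tanhAmp {k k' : ℝ} (hk : 0 < k) (hkk : k < k') :
    tanhAmp k' =o[𝓝[≠] 0] tanhAmp k := by
  refine Asymptotics.isLittleO_iff.2 fun c hc => ?_
  have h : Tendsto (fun w : ℝ => 2 / (Real.pi * (k' - k)) * |w|) (𝓝[≠] 0) (𝓝 0) := by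
    refine Tendsto.mono_left ?_ nhdsWithin_le_nhds
    exact Continuous.tendsto' (by fun_prop) _ _ (by simp)
  filter_upwards [self_mem_nhdsWithin, h.eventually_le_const hc] with w hw hwc
  exact (abs_tanhAmp_le_mul hk hkk hw).trans (mul_le_mul_of_nonneg_right hwc (abs_nonneg _))

/-- The difference is `e^(-y) / sinh y`, with numerator at most 1 and denominator at least `y`. -/
theorem abs_cosh_div_sinh_sub_one_le {y : ℝ} (hy : 0 < y) :
    |Real.cosh y / Real.sinh y - 1| ≤ y⁻¹ := by
  have hs : 0 < Real.sinh y := Real.sinh_pos_iff.2 hy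
  rw [div_sub_one hs.ne', Real.cosh_sub_sinh, abs_of_pos (by positivity), inv_eq_one_div]
  exact div_le_div₀ zero_le_one (Real.exp_le_one_iff.2 (by linarith)) hy
    (Real.self_le_sinh_iff.2 hy.le)

theorem tendsto_cosh_div_sinh {k : ℝ} (hk : 0 < k) :
    Tendsto (fun x : ℝ => Real.cosh (Real.pi * k / (2 * x)) / Real.sinh (Real.pi * k / (2 * x)))
      (𝓝[>] 0) (𝓝 1) := by
  rw [tendsto_iff_norm_sub_tendsto_zero]
  refine squeeze_zero_norm' (a := fun x => 2 * x / (Real.pi * k)) ?_ ?_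
  · filter_upwards [self_mem_nhdsWithin] with x hx
    have hx' : 0 < x := hx
    have hy : 0 < Real.pi * k / (2 * x) := by have := Real.pi_pos; positivity
    rw [norm_norm, Real.norm_eq_abs]
    exact (abs_cosh_div_sinh_sub_one_le hy).trans_eq (inv_div _ _)
  · refine Tendsto.mono_left ?_ nhdsWithin_le_nhds
    exact Continuous.tendsto' (by fun_prop) _ _ (by simp)

/-- The hyperbolic cotangent is odd and tends to 1 at infinity, so the sign of the weight survives
in the limit. -/
theorem tendsto_weightPhase {k : ℝ} (hk : 0 < k) (b : ℝ) {s : ℝ} (hs : s = 1 ∨ s = -1) :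
    Tendsto (fun x => weightPhase k (s * x) b) (𝓝[>] 0)
      (𝓝 ((s * (Real.pi / 2) : ℝ) - b * Complex.I)) := by
  unfold weightPhase
  refine Tendsto.sub_const ((Complex.continuous_ofReal.tendsto _).comp ?_) _
  have h1 := ((tendsto_cosh_div_sinh hk).const_mul (Real.pi / 2)).const_mul s
  have h2 : Tendsto (fun x : ℝ => s * x / k) (𝓝[>] 0) (𝓝 0) := by
    refine Tendsto.mono_left ?_ nhdsWithin_le_nhds
    exact Continuous.tendsto' (by fun_prop) _ _ (by simp)
  have h3 := h1.sub h2
  rw [mul_one, sub_zero] at h3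
  refine h3.congr fun x => ?_
  rcases hs with rfl | rfl
  · simp
  · simp only [neg_mul, one_mul, mul_neg, div_neg, Real.cosh_neg, Real.sinh_neg]

/-! ### Asymptotics of the gradient as the magnitudes tend to zero. -/

/-- Positive magnitudes tending to zero. -/
def smallMagnitudes {r : ℕ} (J : Finset (Fin r)) : Filter (J → ℝ × ℝ) :=
  𝓝[{m | ∀ j, 0 < (m j).1 ∧ 0 < (m j).2}] 0

section Magnitudes

variable {r : ℕ} {J : Finset (Fin r)}

theorem eventually_pos_smallMagnitudes :
    ∀ᶠ m in smallMagnitudes J, ∀ j, 0 < (m j).1 ∧ 0 < (m j).2 := self_mem_nhdsWithin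

theorem tendsto_fst_smallMagnitudes (j : J) :
    Tendsto (fun m => (m j).1) (smallMagnitudes J) (𝓝[>] 0) := by
  refine tendsto_nhdsWithin_iff.2 ⟨?_, eventually_pos_smallMagnitudes.mono fun m hm => (hm j).1⟩
  refine Tendsto.mono_left ?_ nhdsWithin_le_nhds
  exact Continuous.tendsto' (by fun_prop) _ _ rfl

theorem tendsto_snd_smallMagnitudes (j : J) :
    Tendsto (fun m => (m j).2) (smallMagnitudes J) (𝓝[>] 0) := by
  refine tendsto_nhdsWithin_iff.2 ⟨?_, eventually_pos_smallMagnitudes.mono fun m hm => (hm j).2⟩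
  refine Tendsto.mono_left ?_ nhdsWithin_le_nhds
  exact Continuous.tendsto' (by fun_prop) _ _ rfl

theorem eventually_magnitudeBox {P : (J → ℝ × ℝ) → Prop} (h : ∀ᶠ m in smallMagnitudes J, P m) :
    ∀ᶠ δ in 𝓝[>] (0 : ℝ), ∀ m ∈ magnitudeBox J δ, P m := by
  obtain ⟨ε, hε, h⟩ := Metric.mem_nhdsWithin_iff.1 h
  filter_upwards [Ioo_mem_nhdsGT hε] with δ hδ m hm
  refine h ⟨?_, fun j => ⟨(hm j).1.1, (hm j).2.1⟩⟩
  rw [Metric.mem_ball, dist_pi_lt_iff hε]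
  intro j
  obtain ⟨⟨a1, a2⟩, b1, b2⟩ := hm j
  rw [Prod.dist_eq, max_lt_iff]
  simp only [Pi.zero_apply, Prod.fst_zero, Prod.snd_zero, Real.dist_0_eq_abs, abs_of_pos a1,
    abs_of_pos b1]
  exact ⟨a2.trans_lt hδ.2, b2.trans_lt hδ.2⟩

theorem magnitudeBox_mem_smallMagnitudes {δ : ℝ} (hδ : 0 < δ) :
    magnitudeBox J δ ∈ smallMagnitudes J := by
  have h : ∀ j : J, ∀ᶠ m in smallMagnitudes J, m j ∈ Ioc 0 δ ×ˢ Ioc 0 δ := fun j => by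
    filter_upwards [(tendsto_fst_smallMagnitudes j).eventually (Ioc_mem_nhdsGT hδ),
      (tendsto_snd_smallMagnitudes j).eventually (Ioc_mem_nhdsGT hδ)] with m h1 h2
    exact ⟨h1, h2⟩
  exact eventually_all.2 h

instance smallMagnitudes_neBot : (smallMagnitudes J).NeBot := by
  refine ⟨fun h => ?_⟩
  have h0 : ∀ᶠ m in smallMagnitudes J, False := by simp [h]
  obtain ⟨δ, hδ, hpos⟩ := ((eventually_magnitudeBox h0).and self_mem_nhdsWithin).exists
  exact hδ (fun _ => (δ, δ)) fun j => ⟨⟨hpos, le_rfl⟩, hpos, le_rfl⟩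

variable {Θ : Params r}

theorem withMagnitudes_of_notMem {j : Fin r} (hj : j ∉ J) (m : J → ℝ × ℝ) :
    withMagnitudes Θ J m j = Θ j := by
  funext l
  simp [withMagnitudes, hj]

theorem withMagnitudes_weightX (j : J) (m : J → ℝ × ℝ) :
    withMagnitudes Θ J m j .weightX = SignType.sign (Θ j .weightX) * (m j).1 := by
  simp [withMagnitudes]

theorem withMagnitudes_weightY (j : J) (m : J → ℝ × ℝ) :
    withMagnitudes Θ J m j .weightY = SignType.sign (Θ j .weightY) * (m j).2 := by
  simp [withMagnitudes]

theorem withMagnitudes_coeff (j : Fin r) (m : J → ℝ × ℝ) :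
    withMagnitudes Θ J m j .coeff = Θ j .coeff := by
  simp [withMagnitudes]

theorem withMagnitudes_biasX (j : Fin r) (m : J → ℝ × ℝ) :
    withMagnitudes Θ J m j .biasX = Θ j .biasX := by
  simp [withMagnitudes]

theorem withMagnitudes_biasY (j : Fin r) (m : J → ℝ × ℝ) :
    withMagnitudes Θ J m j .biasY = Θ j .biasY := by
  simp [withMagnitudes]

theorem sign_eq_one_or {w : ℝ} (hw : w ≠ 0) :
    ((SignType.sign w : SignType) : ℝ) = 1 ∨ ((SignType.sign w : SignType) : ℝ) = -1 := by
  rcases lt_or_gt_of_ne hw with h | h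
  · right; simp [sign_neg h]
  · left; simp [sign_pos h]

theorem sign_cast_ne_zero {w : ℝ} (hw : w ≠ 0) : ((SignType.sign w : SignType) : ℝ) ≠ 0 := by
  rcases sign_eq_one_or hw with h | h <;> rw [h] <;> norm_num

theorem withMagnitudes_ne_zero (hw : ∀ j, Θ j .weightX ≠ 0 ∧ Θ j .weightY ≠ 0)
    {m : J → ℝ × ℝ} (hm : ∀ j, 0 < (m j).1 ∧ 0 < (m j).2) (j : Fin r) :
    withMagnitudes Θ J m j .weightX ≠ 0 ∧ withMagnitudes Θ J m j .weightY ≠ 0 := by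
  by_cases hj : j ∈ J
  · rw [withMagnitudes_weightX ⟨j, hj⟩, withMagnitudes_weightY ⟨j, hj⟩]
    exact ⟨mul_ne_zero (sign_cast_ne_zero (hw j).1) (hm ⟨j, hj⟩).1.ne',
      mul_ne_zero (sign_cast_ne_zero (hw j).2) (hm ⟨j, hj⟩).2.ne'⟩
  · rw [withMagnitudes_of_notMem hj]
    exact hw j

theorem tendsto_const_mul_nhdsNE {s : ℝ} (hs : s ≠ 0) :
    Tendsto (fun x => s * x) (𝓝[>] 0) (𝓝[≠] 0) := by
  refine tendsto_nhdsWithin_iff.2 ⟨?_, ?_⟩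
  · refine Tendsto.mono_left ?_ nhdsWithin_le_nhds
    exact Continuous.tendsto' (by fun_prop) _ _ (by simp)
  · filter_upwards [self_mem_nhdsWithin] with x hx
    exact mul_ne_zero hs (ne_of_gt hx)

theorem tendsto_weightX (hw : ∀ j, Θ j .weightX ≠ 0 ∧ Θ j .weightY ≠ 0) (j : J) :
    Tendsto (fun m => withMagnitudes Θ J m j .weightX) (smallMagnitudes J) (𝓝[≠] 0) := by
  simp_rw [withMagnitudes_weightX]
  exact (tendsto_const_mul_nhdsNE (sign_cast_ne_zero (hw j).1)).comp (tendsto_fst_smallMagnitudes j)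

theorem tendsto_weightY (hw : ∀ j, Θ j .weightX ≠ 0 ∧ Θ j .weightY ≠ 0) (j : J) :
    Tendsto (fun m => withMagnitudes Θ J m j .weightY) (smallMagnitudes J) (𝓝[≠] 0) := by
  simp_rw [withMagnitudes_weightY]
  exact (tendsto_const_mul_nhdsNE (sign_cast_ne_zero (hw j).2)).comp (tendsto_snd_smallMagnitudes j)

/-- The limit of `derivPhase` for small weights of given signs. -/
noncomputable def derivPhaseLimit (θ : ParamKind → ℝ) : ParamKind → ℂ
  | .coeff => 1
  | .weightX => (SignType.sign (θ .weightX) * (Real.pi / 2) : ℝ) - θ .biasX * Complex.I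
  | .weightY => (SignType.sign (θ .weightY) * (Real.pi / 2) : ℝ) - θ .biasY * Complex.I
  | .biasX => Complex.I
  | .biasY => Complex.I

/-- For the weights the real part is `±π/2`, whatever the bias. -/
theorem derivPhaseLimit_ne_zero {θ : ParamKind → ℝ} (hθ : θ .weightX ≠ 0 ∧ θ .weightY ≠ 0)
    (l : ParamKind) : derivPhaseLimit θ l ≠ 0 := by
  have key : ∀ {w : ℝ} (b : ℝ), w ≠ 0 →
      (((SignType.sign w * (Real.pi / 2) : ℝ) : ℂ) - b * Complex.I) ≠ 0 := fun b hw h => by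
    have h1 := congrArg Complex.re h
    simp only [Complex.sub_re, Complex.ofReal_re, Complex.re_ofReal_mul, Complex.I_re, mul_zero,
      sub_zero, Complex.zero_re] at h1
    exact mul_ne_zero (sign_cast_ne_zero hw) (by positivity) h1
  cases l
  · exact one_ne_zero
  · exact key _ hθ.1
  · exact key _ hθ.2
  · exact Complex.I_ne_zero
  · exact Complex.I_ne_zero

theorem tendsto_derivPhase (hw : ∀ j, Θ j .weightX ≠ 0 ∧ Θ j .weightY ≠ 0) {k : Plane}
    (h0 : 0 < k 0) (h1 : 0 < k 1) (j : J) (l : ParamKind) :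
    Tendsto (fun m => derivPhase (withMagnitudes Θ J m j) k l) (smallMagnitudes J)
      (𝓝 (derivPhaseLimit (Θ j) l)) := by
  cases l
  · exact tendsto_const_nhds
  · simp only [derivPhase, derivPhaseLimit, withMagnitudes_weightX, withMagnitudes_biasX]
    exact (tendsto_weightPhase h0 _ (sign_eq_one_or (hw j).1)).comp (tendsto_fst_smallMagnitudes j)
  · simp only [derivPhase, derivPhaseLimit, withMagnitudes_weightY, withMagnitudes_biasY]
    exact (tendsto_weightPhase h1 _ (sign_eq_one_or (hw j).2)).comp (tendsto_snd_smallMagnitudes j)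
  · exact tendsto_const_nhds
  · exact tendsto_const_nhds

theorem tendsto_neuronAmp (hw : ∀ j, Θ j .weightX ≠ 0 ∧ Θ j .weightY ≠ 0) {k : Plane}
    (h0 : 0 < k 0) (h1 : 0 < k 1) (j : J) :
    Tendsto (fun m => neuronAmp (withMagnitudes Θ J m j) k) (smallMagnitudes J) (𝓝 0) := by
  have h := ((((tendsto_tanhAmp h0).comp (tendsto_weightX hw j)).mul
    ((tendsto_tanhAmp h1).comp (tendsto_weightY hw j))).const_mul (2 * Real.pi)⁻¹).neg
  simpa [neuronAmp] using h

theorem isLittleO_neuronAmp (hw : ∀ j, Θ j .weightX ≠ 0 ∧ Θ j .weightY ≠ 0) {k k' : Plane}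
    (h0 : 0 < k 0) (h0' : k 0 < k' 0) (h1 : 0 < k 1) (h1' : k 1 < k' 1) (j : J) :
    (fun m => neuronAmp (withMagnitudes Θ J m j) k') =o[smallMagnitudes J]
      fun m => neuronAmp (withMagnitudes Θ J m j) k := by
  have h := ((isLittleO_tanhAmp h0 h0').comp_tendsto (tendsto_weightX hw j)).mul
    ((isLittleO_tanhAmp h1 h1').comp_tendsto (tendsto_weightY hw j))
  exact (((Asymptotics.isBigO_refl _ _).mul_isLittleO h).neg_left).neg_right

/-- The scales may blow up as the weights vanish, but their dependence on the frequency is a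
constant factor. Stated without a quotient, this also covers `a = 0`, where most scales vanish. -/
theorem derivScale_eq_mul {k : Plane} (k' : Plane) (h0 : k 0 ≠ 0) (h1 : k 1 ≠ 0) (l : ParamKind) :
    ∃ c : ℝ, ∀ θ, derivScale θ k' l = c * derivScale θ k l := by
  cases l
  · exact ⟨1, fun θ => (one_mul _).symm⟩
  · refine ⟨k' 0 / k 0, fun θ => ?_⟩
    simp only [derivScale]
    field_simp
  · refine ⟨k' 1 / k 1, fun θ => ?_⟩
    simp only [derivScale]
    field_simp
  · refine ⟨k' 0 / k 0, fun θ => ?_⟩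
    simp only [derivScale]
    field_simp
  · refine ⟨k' 1 / k 1, fun θ => ?_⟩
    simp only [derivScale]
    field_simp

theorem isLittleO_neuronAmp_mul (hw : ∀ j, Θ j .weightX ≠ 0 ∧ Θ j .weightY ≠ 0) {k k' : Plane}
    (h0 : 0 < k 0) (h0' : k 0 < k' 0) (h1 : 0 < k 1) (h1' : k 1 < k' 1) (j : J) (l : ParamKind) :
    (fun m => neuronAmp (withMagnitudes Θ J m j) k' * derivScale (withMagnitudes Θ J m j) k' l)
      =o[smallMagnitudes J] fun m =>
        neuronAmp (withMagnitudes Θ J m j) k * derivScale (withMagnitudes Θ J m j) k l := by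
  obtain ⟨c, hc⟩ := derivScale_eq_mul k' h0.ne' h1.ne' l
  refine (isLittleO_neuronAmp hw h0 h0' h1 h1' j).mul_isBigO ?_
  simp_rw [hc]
  exact (Asymptotics.isBigO_refl _ _).const_mul_left c

open Classical in
/-- The limit of the spectral error when the weights of the neurons in `J` tend to zero. -/
noncomputable def limitError (f : 𝓢'(Plane, ℂ)) (Θ : Params r) (J : Finset (Fin r)) (k : Plane) :
    ℂ :=
  ∑ j, (if j ∈ J then 0 else neuronHat (Θ j) k) - spectrumAt f k

/-- The neurons in `J` fade because their amplitudes tend to zero, and the others do not depend on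
the magnitudes. -/
theorem tendsto_spectralError (f : 𝓢'(Plane, ℂ))
    (hw : ∀ j, Θ j .weightX ≠ 0 ∧ Θ j .weightY ≠ 0) {k : Plane} (h0 : 0 < k 0) (h1 : 0 < k 1) :
    Tendsto (fun m => spectralError f (withMagnitudes Θ J m) k) (smallMagnitudes J)
      (𝓝 (limitError f Θ J k)) := by
  classical
  have hlim : Tendsto (fun m => ∑ j, neuronHat (withMagnitudes Θ J m j) k - spectrumAt f k)
      (smallMagnitudes J) (𝓝 (limitError f Θ J k)) := by
    refine Tendsto.sub_const (tendsto_finsetSum _ fun j _ => ?_) _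
    by_cases hj : j ∈ J
    · rw [if_pos hj]
      refine squeeze_zero_norm
        (a := fun m => |Θ j .coeff| * |neuronAmp (withMagnitudes Θ J m j) k|) (fun m => ?_) ?_
      · rw [neuronHat_eq, norm_mul, norm_mul, norm_neuronWave, withMagnitudes_coeff, mul_one,
          Complex.norm_real, Complex.norm_real]
        exact le_rfl
      · simpa using ((tendsto_neuronAmp hw h0 h1 ⟨j, hj⟩).abs).const_mul |Θ j .coeff|
    · rw [if_neg hj]
      simp_rw [withMagnitudes_of_notMem hj]
      exact tendsto_const_nhds
  refine hlim.congr' ?_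
  filter_upwards [eventually_pos_smallMagnitudes] with m hm
  rw [spectralError_eq f (withMagnitudes_ne_zero hw hm) h0.ne' h1.ne']

/-- For small weights the lower frequency dominates, unless the phase of the derivative of the
network is nearly orthogonal to the spectral error. -/
theorem eventually_dominates (f : 𝓢'(Plane, ℂ))
    (hw : ∀ j, Θ j .weightX ≠ 0 ∧ Θ j .weightY ≠ 0) {k k' : Plane}
    (h0 : 0 < k 0) (h0' : k 0 < k' 0) (h1 : 0 < k 1) (h1' : k 1 < k' 1) (j : J) (l : ParamKind)
    {η : ℝ} (hη : 0 < η) :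
    ∀ᶠ m in smallMagnitudes J,
      η ≤ |inner ℝ (limitError f Θ J k)
        (neuronWave (withMagnitudes Θ J m j) k * derivPhaseLimit (Θ j) l)| →
      Dominates f k k' (withMagnitudes Θ J m) j l := by
  -- the error of replacing the phase and the spectral error by their limits
  have hdiff : Tendsto (fun m =>
      inner ℝ (spectralError f (withMagnitudes Θ J m) k)
        (neuronWave (withMagnitudes Θ J m j) k * derivPhase (withMagnitudes Θ J m j) k l) -
      inner ℝ (limitError f Θ J k)
        (neuronWave (withMagnitudes Θ J m j) k * derivPhaseLimit (Θ j) l))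
      (smallMagnitudes J) (𝓝 0) := by
    have hD := tendsto_iff_norm_sub_tendsto_zero.1 (tendsto_spectralError (J := J) f hw h0 h1)
    have hZ := tendsto_derivPhase hw h0 h1 j l
    have hZ' := tendsto_iff_norm_sub_tendsto_zero.1 hZ
    have hb := (hD.mul hZ.norm).add (hZ'.const_mul ‖limitError f Θ J k‖)
    rw [zero_mul, mul_zero, add_zero] at hb
    refine squeeze_zero_norm (fun m => ?_) hb
    set D := spectralError f (withMagnitudes Θ J m) k
    set C := limitError f Θ J k
    set u := neuronWave (withMagnitudes Θ J m j) k with hu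
    set z := derivPhase (withMagnitudes Θ J m j) k l
    set Z := derivPhaseLimit (Θ j) l
    have e : inner ℝ D (u * z) - inner ℝ C (u * Z) =
        inner ℝ (D - C) (u * z) + inner ℝ C (u * (z - Z)) := by
      rw [inner_sub_left, mul_sub, inner_sub_right]
      ring
    rw [e]
    refine (norm_add_le _ _).trans (add_le_add ?_ ?_)
    · refine (norm_inner_le_norm _ _).trans_eq ?_
      rw [norm_mul, hu, norm_neuronWave, one_mul]
    · refine (norm_inner_le_norm _ _).trans_eq ?_
      rw [norm_mul, hu, norm_neuronWave, one_mul]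
  have h0k := h0.trans h0'
  have h1k := h1.trans h1'
  have hbdd : (fun m => (inner ℝ (spectralError f (withMagnitudes Θ J m) k')
      (neuronWave (withMagnitudes Θ J m j) k' * derivPhase (withMagnitudes Θ J m j) k' l) : ℝ))
      =O[smallMagnitudes J] fun _ => (1 : ℝ) := by
    have h := ((tendsto_spectralError (J := J) f hw h0k h1k).norm.mul
      (tendsto_derivPhase hw h0k h1k j l).norm).isBigO_one ℝ
    refine (Asymptotics.IsBigO.of_bound 1 (Eventually.of_forall fun m => ?_)).trans h
    refine (norm_inner_le_norm _ _).trans_eq ?_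
    rw [norm_mul, norm_neuronWave, one_mul, norm_mul, norm_norm, norm_norm, one_mul]
  have hlittle := (isLittleO_neuronAmp_mul hw h0 h0' h1 h1' j l).mul_isBigO hbdd
  -- The margin `η` is split in half: the inner product at `k` stays at least `η / 2` after the
  -- replacement, and the derivative at `k'` is at most `η / 2` times the real factor at `k` (up to
  -- the common 2).
  filter_upwards [eventually_pos_smallMagnitudes, hlittle.def (half_pos hη),
    hdiff.norm.eventually_le_const (by simpa using half_pos hη : ‖(0 : ℝ)‖ < η / 2)] with m hm hsmall hclose hge
  have hw' := withMagnitudes_ne_zero hw hm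
  have d := hasDerivAt_lossAlong f hw' h0.ne' h1.ne' j l
  have d' := hasDerivAt_lossAlong f hw' h0k.ne' h1k.ne' j l
  refine ⟨d.differentiableAt, d'.differentiableAt, ?_⟩
  rw [d.deriv, d'.deriv, ge_iff_le, abs_mul 2, abs_mul 2]
  refine mul_le_mul_of_nonneg_left ?_ (abs_nonneg _)
  rw [Real.norm_eq_abs, Real.norm_eq_abs, mul_one] at hsmall
  refine hsmall.trans ?_
  rw [abs_mul (_ * _), mul_comm]
  refine mul_le_mul_of_nonneg_left ?_ (abs_nonneg _)
  rw [Real.norm_eq_abs] at hclose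
  rw [abs_sub_comm] at hclose
  linarith [abs_sub_abs_le_abs_sub
    (inner ℝ (limitError f Θ J k)
        (neuronWave (withMagnitudes Θ J m j) k * derivPhaseLimit (Θ j) l))
    (inner ℝ (spectralError f (withMagnitudes Θ J m) k)
        (neuronWave (withMagnitudes Θ J m j) k * derivPhase (withMagnitudes Θ J m j) k l))]

end Magnitudes

/-! ### The proportion of magnitudes at which the oscillating cosine is small. -/

/-- Shifting by the nearest zero of the cosine leaves `φ` with `|φ| ≤ π/2` and `|cos θ| = |sin φ|`,
and Jordan's inequality bounds `|sin φ|` below by `2|φ| / π`. -/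
theorem exists_int_abs_sub_le {θ η : ℝ} (h : |Real.cos θ| < η) :
    ∃ n : ℤ, |θ - (n * Real.pi + Real.pi / 2)| ≤ Real.pi / 2 * η := by
  have hpi := Real.pi_pos
  refine ⟨round ((θ - Real.pi / 2) / Real.pi), ?_⟩
  set n := round ((θ - Real.pi / 2) / Real.pi) with hn
  set φ := θ - (n * Real.pi + Real.pi / 2) with hφ
  have h1 : |φ| ≤ Real.pi / 2 := by
    have h2 := abs_sub_round ((θ - Real.pi / 2) / Real.pi)
    have e : φ = ((θ - Real.pi / 2) / Real.pi - n) * Real.pi := by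
      rw [hφ]
      field_simp
      ring
    rw [e, abs_mul, abs_of_pos hpi]
    nlinarith
  have h3 := Real.mul_abs_le_abs_sin h1
  have h4 : |Real.cos θ| = |Real.sin φ| := by
    have e : θ = φ + Real.pi / 2 + n * Real.pi := by
      rw [hφ]
      ring
    rw [e, Real.cos_add_int_mul_pi, abs_mul, Real.cos_add_pi_div_two, abs_neg, abs_zpow, abs_neg,
      abs_one, one_zpow, one_mul]
  rw [h4] at h
  have h5 : 2 / Real.pi * |φ| ≤ η := h3.trans h.le
  calc |φ| = Real.pi / 2 * (2 / Real.pi * |φ|) := by field_simp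
    _ ≤ _ := by gcongr

/-- The diameter bounds the measure: `x - y = (α/y - α/x) · xy / α`, where the first factor is at
most `2κ` in modulus and `xy ≤ δ²`. -/
theorem volume_near_div_le {α δ κ : ℝ} (hα : α ≠ 0) (t : ℝ) :
    volume {x : ℝ | x ∈ Ioc 0 δ ∧ |α / x - t| ≤ κ} ≤ ENNReal.ofReal (2 * κ * δ ^ 2 / |α|) := by
  refine (Real.volume_le_diam _).trans (Metric.ediam_le fun x hx y hy => ?_)
  obtain ⟨⟨hx0, hxδ⟩, hx⟩ := hx
  obtain ⟨⟨hy0, hyδ⟩, hy⟩ := hy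
  rw [edist_dist, Real.dist_eq]
  refine ENNReal.ofReal_le_ofReal ?_
  have hα' := abs_pos.2 hα
  have h1 : |α / y - α / x| ≤ 2 * κ := by
    rw [abs_le] at hx hy ⊢
    constructor <;> linarith [hx.1, hx.2, hy.1, hy.2]
  have e : x - y = (α / y - α / x) * (x * y) / α := by field_simp
  rw [e, abs_div, abs_mul, abs_of_pos (mul_pos hx0 hy0)]
  have h2 : x * y ≤ δ ^ 2 := by nlinarith
  have h3 := (abs_nonneg _).trans h1
  gcongr

/-- The proportion of the small `x` for which `cos (α / x + γ)` is nearly zero is small. -/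
theorem exists_volume_cos_div_le {α ε : ℝ} (hα : α ≠ 0) (hε : 0 < ε) :
    ∃ η > 0, ∃ δ₁ > 0, ∀ δ, 0 < δ → δ ≤ δ₁ → ∀ γ : ℝ,
      volume {x : ℝ | x ∈ Ioc 0 δ ∧ |Real.cos (α / x + γ)| < η} ≤ ENNReal.ofReal (ε * δ) := by
  have hpi := Real.pi_pos
  have hpi3 := Real.pi_gt_three
  have hα' := abs_pos.2 hα
  -- `κ` is the allowed distance of the angle to a zero of the cosine; `16 κ ≤ ε²` gives `4κ / ε ≤ ε
  -- / 4` at the end.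
  obtain ⟨κ, hκ0, hκ1, hκε⟩ : ∃ κ : ℝ, 0 < κ ∧ κ ≤ 1 ∧ 16 * κ ≤ ε ^ 2 := by
    refine ⟨min 1 (ε ^ 2 / 16), lt_min one_pos (by positivity), min_le_left _ _, ?_⟩
    linarith [min_le_right 1 (ε ^ 2 / 16)]
  refine ⟨2 / Real.pi * κ, by positivity, ε * |α| / 16, by positivity, fun δ hδ hδ₁ γ => ?_⟩
  -- Points `x ≤ εδ/2` are discarded at a cost of half the allowed measure. On the rest `|α / x| ≤
  -- M`, so only the zeros with index between `lo` and `hi` matter.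
  set M := 2 * |α| / (ε * δ) with hM
  set lo := (γ - Real.pi / 2 - κ - M) / Real.pi with hlo
  set hi := (γ - Real.pi / 2 + κ + M) / Real.pi with hhi
  have hsub : {x : ℝ | x ∈ Ioc 0 δ ∧ |Real.cos (α / x + γ)| < 2 / Real.pi * κ} ⊆
      Ioc 0 (ε * δ / 2) ∪ ⋃ n ∈ Finset.Icc ⌈lo⌉ ⌊hi⌋,
        {x : ℝ | x ∈ Ioc 0 δ ∧ |α / x - (n * Real.pi + Real.pi / 2 - γ)| ≤ κ} := by
    rintro x ⟨hx, hc⟩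
    by_cases hxs : x ≤ ε * δ / 2
    · exact Or.inl ⟨hx.1, hxs⟩
    right
    push Not at hxs
    obtain ⟨n, hn⟩ := exists_int_abs_sub_le hc
    have hn' : |α / x - (n * Real.pi + Real.pi / 2 - γ)| ≤ κ := by
      calc _ = |α / x + γ - (n * Real.pi + Real.pi / 2)| := by congr 1; ring
        _ ≤ _ := hn
        _ = κ := by field_simp
    have hxM : |α / x| ≤ M := by
      rw [abs_div, abs_of_pos hx.1, hM, div_le_div_iff₀ hx.1 (by positivity)]
      nlinarith
    rw [mem_iUnion₂]
    refine ⟨n, ?_, hx, hn'⟩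
    rw [abs_le] at hn' hxM
    rw [Finset.mem_Icc, Int.ceil_le, Int.le_floor, hlo, hhi, div_le_iff₀ hpi, le_div_iff₀ hpi]
    constructor <;> linarith [hn'.1, hn'.2, hxM.1, hxM.2]
  have hM0 : 0 < M := by positivity
  have hcard : ((Finset.Icc ⌈lo⌉ ⌊hi⌋).card : ℝ) ≤ 2 + M := by
    have hd : hi - lo ≤ 1 + M := by
      rw [hhi, hlo, ← sub_div, div_le_iff₀ hpi]
      nlinarith
    rw [Int.card_Icc]
    have h1 : ((⌊hi⌋ + 1 - ⌈lo⌉ : ℤ) : ℝ) ≤ 2 + M := by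
      push_cast
      linarith [Int.floor_le hi, Int.le_ceil lo]
    rcases le_total 0 (⌊hi⌋ + 1 - ⌈lo⌉) with h | h
    · have h2 : (((⌊hi⌋ + 1 - ⌈lo⌉).toNat : ℤ) : ℝ) = ((⌊hi⌋ + 1 - ⌈lo⌉ : ℤ) : ℝ) := by
        rw [Int.toNat_of_nonneg h]
      rw [← h2] at h1
      exact_mod_cast h1
    · rw [Int.toNat_of_nonpos h]
      push_cast
      linarith
  refine (measure_mono hsub).trans ((measure_union_le _ _).trans ?_)
  refine (add_le_add le_rfl (measure_biUnion_finset_le _ _)).trans ?_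
  refine (add_le_add le_rfl (Finset.sum_le_sum fun n _ => volume_near_div_le hα _)).trans ?_
  rw [Finset.sum_const, nsmul_eq_mul, Real.volume_Ioc, sub_zero,
    ← ENNReal.ofReal_natCast, ← ENNReal.ofReal_mul (by positivity),
    ← ENNReal.ofReal_add (by positivity) (by positivity)]
  refine ENNReal.ofReal_le_ofReal ?_
  -- The zeros contribute at most `δ (ε/4 + ε/4)`, the other half of the allowed measure.
  have h1 : ((Finset.Icc ⌈lo⌉ ⌊hi⌋).card : ℝ) * (2 * κ * δ ^ 2 / |α|) ≤
      (2 + M) * (2 * κ * δ ^ 2 / |α|) := by gcongr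
  have h2 : (2 + M) * (2 * κ * δ ^ 2 / |α|) = δ * (4 * κ * (δ / |α|) + 4 * κ / ε) := by
    rw [hM]
    field_simp
    ring
  have h3 : δ / |α| ≤ ε / 16 := by
    rw [div_le_iff₀ hα']
    linarith
  have h4 : 4 * κ / ε ≤ ε / 4 := by
    rw [div_le_iff₀ hε]
    nlinarith
  have h5 : 4 * κ * (δ / |α|) ≤ ε / 4 := by
    have : 0 ≤ δ / |α| := by positivity
    nlinarith
  nlinarith

/-- Oscillation in the first coordinate suffices: on the slice at height `y` the term `β / y` joins
the shift, and the one-dimensional bound is uniform in the shift. -/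
theorem exists_volume_cos_div_add_div_le {α ε : ℝ} (hα : α ≠ 0) (hε : 0 < ε) :
    ∃ η > 0, ∃ δ₁ > 0, ∀ δ, 0 < δ → δ ≤ δ₁ → ∀ β γ : ℝ,
      volume ({p : ℝ × ℝ | |Real.cos (α / p.1 + β / p.2 + γ)| < η} ∩ Ioc 0 δ ×ˢ Ioc 0 δ) ≤
        ENNReal.ofReal ε * volume (Ioc 0 δ ×ˢ Ioc 0 δ : Set (ℝ × ℝ)) := by
  obtain ⟨η, hη, δ₁, hδ₁, h⟩ := exists_volume_cos_div_le hα hε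
  refine ⟨η, hη, δ₁, hδ₁, fun δ hδ hδδ β γ => ?_⟩
  have hm : MeasurableSet ({p : ℝ × ℝ | |Real.cos (α / p.1 + β / p.2 + γ)| < η} ∩
      Ioc 0 δ ×ˢ Ioc 0 δ) := by
    refine (measurableSet_lt ?_ measurable_const).inter (measurableSet_Ioc.prod measurableSet_Ioc)
    fun_prop
  rw [Measure.volume_eq_prod, Measure.prod_apply_symm hm]
  calc _ ≤ ∫⁻ y, (Ioc 0 δ).indicator (fun _ => ENNReal.ofReal (ε * δ)) y := by
        refine lintegral_mono fun y => ?_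
        by_cases hy : y ∈ Ioc 0 δ
        · rw [indicator_of_mem hy]
          refine (measure_mono fun x hx => ?_).trans (h δ hδ hδδ (β / y + γ))
          exact ⟨hx.2.1, by simpa [add_assoc] using hx.1⟩
        · rw [indicator_of_notMem hy]
          refine le_of_eq (measure_mono_null (t := ∅) (fun x hx => ?_) measure_empty)
          exact (hy hx.2.2).elim
    _ = _ := by
        rw [lintegral_indicator measurableSet_Ioc, setLIntegral_const, Measure.prod_prod,
          Real.volume_Ioc, sub_zero, ENNReal.ofReal_mul hε.le, mul_assoc]

/-! ### Density in the box of magnitudes. -/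

section Box

variable {r : ℕ} {J : Finset (Fin r)}

theorem magnitudeBox_eq_pi (δ : ℝ) :
    magnitudeBox J δ = univ.pi fun _ => Ioc 0 δ ×ˢ Ioc 0 δ := by
  ext m
  simp [magnitudeBox]

theorem volume_magnitudeBox {δ : ℝ} (hδ : 0 ≤ δ) :
    volume (magnitudeBox J δ) = ENNReal.ofReal (δ ^ (2 * J.card)) := by
  rw [magnitudeBox_eq_pi, volume_pi_pi, Finset.prod_const, Measure.volume_eq_prod,
    Measure.prod_prod, Real.volume_Ioc, sub_zero, ← ENNReal.ofReal_mul hδ, Finset.card_univ,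
    Fintype.card_coe, ← ENNReal.ofReal_pow (by positivity), ← sq, ← pow_mul]

/-- The box is a product and the condition constrains a single factor. -/
theorem volume_preimage_inter_magnitudeBox_le {B : Set (ℝ × ℝ)} {δ : ℝ} {ε : ℝ≥0∞} (j : J)
    (hB : volume (B ∩ Ioc 0 δ ×ˢ Ioc 0 δ) ≤ ε * volume (Ioc 0 δ ×ˢ Ioc 0 δ : Set (ℝ × ℝ))) :
    volume ({m : J → ℝ × ℝ | m j ∈ B} ∩ magnitudeBox J δ) ≤ ε * volume (magnitudeBox J δ) := by
  classical
  have hsub : {m : J → ℝ × ℝ | m j ∈ B} ∩ magnitudeBox J δ ⊆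
      univ.pi fun i => if i = j then B ∩ Ioc 0 δ ×ˢ Ioc 0 δ else Ioc 0 δ ×ˢ Ioc 0 δ := by
    rintro m ⟨h1, h2⟩ i -
    by_cases hi : i = j
    · subst hi
      simpa using ⟨h1, h2 i⟩
    · simpa [hi] using h2 i
  refine (measure_mono hsub).trans ?_
  rw [volume_pi_pi, magnitudeBox_eq_pi, volume_pi_pi]
  calc _ ≤ ∏ i : J, (if i = j then ε else 1) *
        volume (Ioc 0 δ ×ˢ Ioc 0 δ : Set (ℝ × ℝ)) := by
        refine Finset.prod_le_prod' fun i _ => ?_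
        by_cases hi : i = j
        · simpa [hi] using hB
        · simp [hi]
    _ = _ := by
        rw [Finset.prod_mul_distrib, Finset.prod_ite_eq' Finset.univ j]
        simp

/-- A set of magnitudes has density one at zero if its complement is covered, for each `ε`, by
finitely many sets of density at most `ε`. -/
theorem tendsto_volume_div_of_cover {ι : Type*} [Fintype ι] {G : Set (J → ℝ × ℝ)}
    (h : ∀ ε : ℝ, 0 < ε → ∃ B : ι → Set (J → ℝ × ℝ), ∀ᶠ δ in 𝓝[>] (0 : ℝ),
      (∀ m ∈ magnitudeBox J δ, (∀ i, m ∉ B i) → m ∈ G) ∧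
      ∀ i, volume (B i ∩ magnitudeBox J δ) ≤ ENNReal.ofReal ε * volume (magnitudeBox J δ)) :
    Tendsto (fun δ : ℝ => volume.real (G ∩ magnitudeBox J δ) / δ ^ (2 * J.card))
      (𝓝[>] 0) (𝓝 1) := by
  refine tendsto_order.2 ⟨fun a ha => ?_, fun a ha => ?_⟩
  -- All bad sets together must stay below density `1 - a`; the `+ 1` in the witness allows an empty
  -- index type.
  · obtain ⟨ε, hε, hεa⟩ : ∃ ε : ℝ, 0 < ε ∧ Fintype.card ι * ε < 1 - a := by
      refine ⟨(1 - a) / (Fintype.card ι + 1), div_pos (by linarith) (by positivity), ?_⟩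
      rw [mul_div_assoc', div_lt_iff₀ (by positivity)]
      nlinarith
    obtain ⟨B, hB⟩ := h ε hε
    filter_upwards [hB, self_mem_nhdsWithin] with δ ⟨hδG, hδB⟩ hδ
    have hδ0 : 0 < δ := hδ
    -- Only monotonicity and subadditivity are applied to this cover, so neither `G` nor the `B i`
    -- need be measurable.
    have hsub : magnitudeBox J δ ⊆ (G ∩ magnitudeBox J δ) ∪ ⋃ i, (B i ∩ magnitudeBox J δ) := by
      intro m hm
      by_cases hmB : ∀ i, m ∉ B i
      · exact Or.inl ⟨hδG m hm hmB, hm⟩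
      · push Not at hmB
        obtain ⟨i, hi⟩ := hmB
        exact Or.inr (mem_iUnion.2 ⟨i, hi, hm⟩)
    have hfin : volume (G ∩ magnitudeBox J δ) ≠ ∞ :=
      ((measure_mono inter_subset_right).trans_lt (by
        rw [volume_magnitudeBox hδ0.le]
        exact ENNReal.ofReal_lt_top)).ne
    have hle : volume (magnitudeBox J δ) ≤ volume (G ∩ magnitudeBox J δ) +
        ENNReal.ofReal (Fintype.card ι * ε) * volume (magnitudeBox J δ) := by
      refine (measure_mono hsub).trans ((measure_union_le _ _).trans (add_le_add le_rfl ?_))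
      refine (measure_iUnion_fintype_le _ _).trans ((Finset.sum_le_sum fun i _ => hδB i).trans ?_)
      rw [Finset.sum_const, nsmul_eq_mul, ENNReal.ofReal_mul (by positivity),
        ENNReal.ofReal_natCast, Finset.card_univ, mul_assoc]
    rw [volume_magnitudeBox hδ0.le, ← ENNReal.ofReal_mul (by positivity),
      ← ENNReal.ofReal_toReal hfin, ← ENNReal.ofReal_add ENNReal.toReal_nonneg (by positivity),
      ENNReal.ofReal_le_ofReal_iff (by positivity)] at hle
    have hp : 0 < δ ^ (2 * J.card) := by positivity
    rw [lt_div_iff₀ hp, Measure.real]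
    nlinarith
  · filter_upwards [self_mem_nhdsWithin] with δ hδ
    have hδ0 : 0 < δ := hδ
    refine lt_of_le_of_lt ?_ ha
    rw [div_le_one (by positivity), Measure.real]
    refine ENNReal.toReal_le_of_le_ofReal (by positivity) ?_
    rw [← volume_magnitudeBox hδ0.le]
    exact measure_mono inter_subset_right

end Box

/-! ### Assembly of the theorem. -/

instance : Fintype ParamKind :=
  ⟨{.coeff, .weightX, .weightY, .biasX, .biasY}, fun l => by cases l <;> simp⟩

/-- The real inner product is the real part of `conj C` times the second argument; in polar form
this is a cosine. It turns near-orthogonality into smallness of the cosine. -/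
theorem inner_exp_mul (C Z : ℂ) (ψ : ℝ) :
    (inner ℝ C (Complex.exp (ψ * Complex.I) * Z) : ℝ) =
      ‖C‖ * ‖Z‖ * Real.cos (ψ + Complex.arg (starRingEnd ℂ C * Z)) := by
  have h : starRingEnd ℂ C * (Complex.exp (ψ * Complex.I) * Z) =
      ((‖C‖ * ‖Z‖ : ℝ) : ℂ) *
        Complex.exp ((ψ + Complex.arg (starRingEnd ℂ C * Z) : ℝ) * Complex.I) := by
    have h1 := Complex.norm_mul_exp_arg_mul_I (starRingEnd ℂ C * Z)
    rw [norm_mul, RCLike.norm_conj] at h1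
    push_cast at h1 ⊢
    rw [add_mul, Complex.exp_add]
    linear_combination (-Complex.exp (ψ * Complex.I)) * h1
  rw [Complex.inner, mul_comm, h, Complex.re_ofReal_mul, Complex.exp_ofReal_mul_I_re]

theorem neuronWave_withMagnitudes {r : ℕ} {J : Finset (Fin r)} (Θ : Params r) (k : Plane) (j : J)
    (m : J → ℝ × ℝ) :
    neuronWave (withMagnitudes Θ J m j) k = Complex.exp
      ((k 0 * Θ j .biasX / SignType.sign (Θ j .weightX) / (m j).1 +
        k 1 * Θ j .biasY / SignType.sign (Θ j .weightY) / (m j).2 : ℝ) * Complex.I) := by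
  rw [neuronWave, withMagnitudes_weightX, withMagnitudes_weightY, withMagnitudes_biasX,
    withMagnitudes_biasY, div_div, div_div]

/-- A uniform positive lower bound on the norm passes to the limit, since `smallMagnitudes` is a
nontrivial filter. -/
theorem limitError_ne_zero {r : ℕ} {J : Finset (Fin r)} (f : 𝓢'(Plane, ℂ)) {Θ : Params r}
    (hw : ∀ j, Θ j .weightX ≠ 0 ∧ Θ j .weightY ≠ 0) {k : Plane} (h0 : 0 < k 0) (h1 : 0 < k 1)
    {c : ℝ} (hc : 0 < c)
    (h : ∀ᶠ m in smallMagnitudes J, c < ‖spectralError f (withMagnitudes Θ J m) k‖) :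
    limitError f Θ J k ≠ 0 :=
  norm_pos_iff.1 (hc.trans_le
    (ge_of_tendsto (tendsto_spectralError f hw h0 h1).norm (h.mono fun _ hm => hm.le)))

theorem mainTheorem1 {r : ℕ} (f : 𝓢'(Plane, ℂ)) (k₁ k₂ : Plane)
    (hx₁ : 0 < k₁ 0) (hx₂ : k₁ 0 < k₂ 0) (hy₁ : 0 < k₁ 1) (hy₂ : k₁ 1 < k₂ 1)
    (hf₁ : HasSpectrumAt f k₁) (hf₂ : HasSpectrumAt f k₂)
    (Θ : Params r)
    (hw : ∀ j, Θ j .weightX ≠ 0 ∧ Θ j .weightY ≠ 0)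
    (hb : ∀ j, Θ j .biasX ≠ 0 ∧ Θ j .biasY ≠ 0)
    (J : Finset (Fin r))
    (hD : ∃ c₁ > (0 : ℝ), ∃ c₂ > (0 : ℝ), ∃ δ₀ > (0 : ℝ), ∀ m ∈ magnitudeBox J δ₀,
      c₁ < ‖spectralError f (withMagnitudes Θ J m) k₁‖ ∧
      ‖spectralError f (withMagnitudes Θ J m) k₂‖ < c₂) :
    (∀ Θ' : Params r, (∀ j, Θ' j .weightX ≠ 0 ∧ Θ' j .weightY ≠ 0) →
      HasSpectrumAt (tnnDist Θ') k₁ ∧ HasSpectrumAt (tnnDist Θ') k₂) ∧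
    Tendsto
      (fun δ : ℝ =>
        volume.real ({m : J → ℝ × ℝ | ∀ j ∈ J, ∀ l : ParamKind,
          Dominates f k₁ k₂ (withMagnitudes Θ J m) j l} ∩ magnitudeBox J δ)
          / δ ^ (2 * J.card))
      (𝓝[>] 0) (𝓝 1) := by
  refine ⟨fun Θ' hΘ' => ⟨⟨_, hasValueAt_fourier_tnnDist_smul hΘ' hx₁.ne' hy₁.ne'⟩,
    ⟨_, hasValueAt_fourier_tnnDist_smul hΘ' (hx₁.trans hx₂).ne' (hy₁.trans hy₂).ne'⟩⟩, ?_⟩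
  obtain ⟨c₁, hc₁, c₂, -, δ₀, hδ₀, hD⟩ := hD
  have hC : limitError f Θ J k₁ ≠ 0 := limitError_ne_zero f hw hx₁ hy₁ hc₁ (by
    filter_upwards [magnitudeBox_mem_smallMagnitudes hδ₀] with m hm
    exact (hD m hm).1)
  set C := limitError f Θ J k₁ with hCdef
  set α : J → ℝ := fun j => k₁ 0 * Θ j .biasX / SignType.sign (Θ j .weightX) with hα
  set β : J → ℝ := fun j => k₁ 1 * Θ j .biasY / SignType.sign (Θ j .weightY) with hβ
  have hα0 : ∀ j, α j ≠ 0 := fun j =>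
    div_ne_zero (mul_ne_zero hx₁.ne' (hb j).1) (sign_cast_ne_zero (hw j).1)
  refine tendsto_volume_div_of_cover (ι := J × ParamKind) fun ε hε => ?_
  choose η hη δ₁ hδ₁ hvol using fun j => exists_volume_cos_div_add_div_le (hα0 j) hε
  set γ : J × ParamKind → ℝ := fun i =>
    Complex.arg (starRingEnd ℂ C * derivPhaseLimit (Θ i.1) i.2)
  set B : J × ParamKind → Set (ℝ × ℝ) := fun i =>
    {p | |Real.cos (α i.1 / p.1 + β i.1 / p.2 + γ i)| < η i.1} with hB
  refine ⟨fun i => {m | m i.1 ∈ B i}, ?_⟩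
  have hdom : ∀ᶠ m in smallMagnitudes J, ∀ i : J × ParamKind, m i.1 ∉ B i →
      Dominates f k₁ k₂ (withMagnitudes Θ J m) i.1 i.2 := by
    refine eventually_all.2 fun i => ?_
    have hZ : 0 < ‖C‖ * ‖derivPhaseLimit (Θ i.1) i.2‖ :=
      mul_pos (norm_pos_iff.2 hC) (norm_pos_iff.2 (derivPhaseLimit_ne_zero (hw i.1) i.2))
    -- The threshold for the inner product is the cosine threshold `η` scaled by the norms of the
    -- two limits.
    filter_upwards [eventually_dominates f hw hx₁ hx₂ hy₁ hy₂ i.1 i.2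
      (mul_pos hZ (hη i.1))] with m hm hmB
    refine hm ?_
    rw [neuronWave_withMagnitudes, inner_exp_mul, abs_mul, abs_of_pos hZ]
    exact mul_le_mul_of_nonneg_left (not_lt.1 hmB) hZ.le
  have hδ : ∀ᶠ δ in 𝓝[>] (0 : ℝ), ∀ j, δ ≤ δ₁ j := eventually_all.2 fun j =>
    nhdsWithin_le_nhds (Iic_mem_nhds (hδ₁ j))
  filter_upwards [eventually_magnitudeBox hdom, hδ, self_mem_nhdsWithin] with δ h1 h2 h3
  exact ⟨fun m hm hmB j hj l => h1 m hm (⟨j, hj⟩, l) (hmB (⟨j, hj⟩, l)),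
    fun i => volume_preimage_inter_magnitudeBox_le i.1 (hvol i.1 δ h3 (h2 i.1) _ _)⟩
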